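/- **Setting.** Let $T>0$, let $X$ be a real Banach space, $Y$ a real Hilbert space and $Z$ a real reflexive Banach space that is compactly embedded in $Y^*$ (by an injective compact linear map). For a Banach space $E$ let $H^1(0,T;E)$ be the space of all $u\in L^2(0,T;E)$ with weak derivative $\dot u\in L^2(0,T;E)$, normed by $\|u\|_{H^1(0,T;E)}^2=\|u\|_{L^2(0,T;E)}^2+\|\dot u\|_{L^2(0,T;E)}^2$, and $H^1_0(0,T;E)=\{u\in H^1(0,T;E): u(0)=0\}$. Let $A\in\mathcal L(Y,Y)$ be self-adjoint with $(Ay,y)_Y\ge\alpha\|y\|_Y^2$ for all $y\in Y$ and some $\alpha>0$, and for a load $\ell:(0,T)\to Y^*$ put $\mathcal E(t,q)=\tfrac12(Aq,q)_Y-\langle\ell(t),q\rangle_Y$. Let $B\in W^{1,1}(0,T;\mathcal L(Y,X))$, $y_0\in X$ and $$\mathcal H(y)(t)=\int_0^tB(t-s)\,y(s)\,ds+y_0 .$$ Let $\mathcal R:X\times Y\to[0,\infty]$ be such that, for every $\zeta\in X$, $\mathcal R(\zeta,\cdot)$ is proper, convex, lower semicontinuous and satisfies $\mathcal R(\zeta,\gamma\eta)=\gamma\mathcal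 R(\zeta,\eta)$ for all $\gamma\ge0$, $\eta\in Y$ (with $0\cdot\infty=0$); that the domain $\{\eta:\mathcal R(\zeta,\eta)<\infty\}=:\operatorname{dom}\mathcal R$ does not depend on $\zeta$; and that for some $L_{\mathcal R}\ge0$ $$\mathcal R(\zeta_1,\eta_2)-\mathcal R(\zeta_1,\eta_1)+\mathcal R(\zeta_2,\eta_1)-\mathcal R(\zeta_2,\eta_2)\le L_{\mathcal R}\|\zeta_1-\zeta_2\|_X\|\eta_1-\eta_2\|_Y$$ for all $\zeta_1,\zeta_2\in X$ and $\eta_1,\eta_2\in\operatorname{dom}\mathcal R$. Let $\mathcal Y=\{y\in H^1_0(0,T;Y):\dot y(t)\in\operatorname{dom}\mathcal R\text{ for a.a. }t\in(0,T)\}$. Assume that $\operatorname{dom}\mathcal R$ is closed in $Y$ and that, whenever $(y_m)\subset\mathcal Y$ and $y_m\rightharpoonup y$ in $H^1_0(0,T;Y)$: 1. $\displaystyle\int_0^T\mathcal R(\mathcal H(y)(t),\dot y(t))\,dt\le\liminf_{m\to\infty}\int_0^T\mathcal R(\mathcal H(y_m)(t),\dot y_m(t))\,dt$; 2. for every $v\in\mathcal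 Y$ there is a sequence $(v_m)\subset\mathcal Y$ with $v_m\to v$ in $H^1_0(0,T;Y)$ and $\displaystyle\limsup_{m\to\infty}\int_0^T\mathcal R(\mathcal H(y_m)(t),\dot v_m(t))\,dt\le\int_0^T\mathcal R(\mathcal H(y)(t),\dot v(t))\,dt$. Finally, let $j:H^1_0(0,T;Y)\to\mathbb R$ be bounded from below and (sequentially) weakly lower semicontinuous. **Theorem.** The minimization problem $$\min\ j(q)+\tfrac12\|\ell\|_{H^1(0,T;Z)}^2\quad\text{over all }(\ell,q)\in H^1_0(0,T;Z)\times H^1_0(0,T;Y)\text{ such that}$$ $$-\partial_q\mathcal E(t,q(t))\in\partial_2\mathcal R(\mathcal H(q)(t),\dot q(t))\ \text{ in }Y^*\ \text{ for a.a. }t\in(0,T),\qquad q(0)=0,$$ where $\partial_2\mathcal R(\zeta,\eta)\subset Y^*$ is the convex subdifferential of $\mathcal R(\zeta,\cdot)$ at $\eta$ and $\ell$ is viewed as a $Y^*$-valued function through the embedding $Z\hookrightarrow Y^*$, has at least one solution: there is an admissible pair $(\ell,q)$ whose objective value is at most that of every other admissible pair. -/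

import Mathlib

open MeasureTheory Filter Set
open scoped Topology ENNReal NNReal ContDiff

noncomputable section

namespace HistoryRIS

/-! ### Bochner–Sobolev spaces on a time interval -/

section Sobolev

/-- Lebesgue measure on the open interval `(0, T)`. -/
abbrev timeMeasure (T : ℝ) : Measure ℝ := volume.restrict (Ioo 0 T)

variable {E : Type*} [NormedAddCommGroup E] [NormedSpace ℝ E]

/-- `g` is the weak (distributional) derivative of the vector-valued function `u` on `(0, T)`:
`∫ φ' u = - ∫ φ g` for all real test functions `φ ∈ C_c^∞(0, T)`. -/
def HasWeakDeriv (T : ℝ) (u g : ℝ → E) : Prop :=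
  ∀ φ : ℝ → ℝ, ContDiff ℝ ∞ φ → HasCompactSupport φ → tsupport φ ⊆ Ioo 0 T →
    ∫ t, deriv φ t • u t ∂(timeMeasure T) = -∫ t, φ t • g t ∂(timeMeasure T)

/-- `B ∈ W^{1,1}(0, T; E)`. -/
def MemW11 (T : ℝ) (B : ℝ → E) : Prop :=
  Integrable B (timeMeasure T) ∧
    ∃ B' : ℝ → E, Integrable B' (timeMeasure T) ∧ HasWeakDeriv T B B'

variable (E) in
/-- Pairs `(u, g) ∈ L²(0,T;E) × L²(0,T;E)` with the norm `(‖u‖² + ‖g‖²)^{1/2}`. -/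
abbrev L2Pair (T : ℝ) : Type _ :=
  WithLp 2 (Lp E 2 (timeMeasure T) × Lp E 2 (timeMeasure T))

theorem integrable_test_smul {T : ℝ} {ψ : ℝ → ℝ} (hψ : Continuous ψ) (hc : HasCompactSupport ψ)
    (u : Lp E 2 (timeMeasure T)) : Integrable (fun t => ψ t • u t) (timeMeasure T) := by
  have hu : Integrable (u : ℝ → E) (timeMeasure T) :=
    (Lp.memLp u).integrable (by norm_num)
  obtain ⟨C, hC⟩ := hc.exists_bound_of_continuous hψ
  exact hu.bdd_smul C hψ.aestronglyMeasurable (ae_of_all _ hC)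

end Sobolev

/-- The space `H¹(0, T; E)`, realised as the space of pairs `(u, u')` where `u ∈ L²(0,T;E)` has the
weak derivative `u' ∈ L²(0,T;E)`. The norm inherited from `L2Pair` is the usual one,
`‖u‖²_{H¹} = ‖u‖²_{L²} + ‖u'‖²_{L²}`. -/
def H1 (T : ℝ) (E : Type*) [NormedAddCommGroup E] [NormedSpace ℝ E] :
    Submodule ℝ (L2Pair E T) where
  carrier := {w | HasWeakDeriv T (w.fst : ℝ → E) (w.snd : ℝ → E)}
  zero_mem' := by
    intro φ _ _ _
    have h : ∀ ψ : ℝ → ℝ, ∫ t, ψ t • (0 : Lp E 2 (timeMeasure T)) t ∂(timeMeasure T) = 0 := by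
      intro ψ
      rw [← integral_zero ℝ E]
      refine integral_congr_ae ?_
      filter_upwards [Lp.coeFn_zero E 2 (timeMeasure T)] with t ht
      rw [ht, Pi.zero_apply, smul_zero]
    change ∫ t, deriv φ t • (0 : Lp E 2 (timeMeasure T)) t ∂(timeMeasure T)
      = -∫ t, φ t • (0 : Lp E 2 (timeMeasure T)) t ∂(timeMeasure T)
    rw [h, h, neg_zero]
  add_mem' := by
    intro a b ha hb φ h1 h2 h3
    have key : ∀ ψ : ℝ → ℝ, Continuous ψ → HasCompactSupport ψ →
        ∀ u v : Lp E 2 (timeMeasure T), ∫ t, ψ t • (u + v) t ∂(timeMeasure T)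
          = ∫ t, ψ t • u t ∂(timeMeasure T) + ∫ t, ψ t • v t ∂(timeMeasure T) := by
      intro ψ hψ hc u v
      rw [← integral_add (integrable_test_smul hψ hc u) (integrable_test_smul hψ hc v)]
      refine integral_congr_ae ?_
      filter_upwards [Lp.coeFn_add u v] with t ht
      rw [ht, Pi.add_apply, smul_add]
    change ∫ t, deriv φ t • (a.fst + b.fst) t ∂(timeMeasure T)
      = -∫ t, φ t • (a.snd + b.snd) t ∂(timeMeasure T)
    rw [key _ (h1.continuous_deriv (by norm_num)) h2.deriv, key _ h1.continuous h2,
      ha φ h1 h2 h3, hb φ h1 h2 h3, neg_add]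
  smul_mem' := by
    intro c a ha φ h1 h2 h3
    have key : ∀ ψ : ℝ → ℝ, ∀ u : Lp E 2 (timeMeasure T),
        ∫ t, ψ t • (c • u) t ∂(timeMeasure T) = c • ∫ t, ψ t • u t ∂(timeMeasure T) := by
      intro ψ u
      rw [← integral_smul]
      refine integral_congr_ae ?_
      filter_upwards [Lp.coeFn_smul c u] with t ht
      rw [ht, Pi.smul_apply, smul_comm]
    change ∫ t, deriv φ t • (c • a.fst) t ∂(timeMeasure T)
      = -∫ t, φ t • (c • a.snd) t ∂(timeMeasure T)
    rw [key, key, ha φ h1 h2 h3, smul_neg]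

/-- The space `H¹₀(0, T; E) = {u ∈ H¹(0, T; E) : u(0) = 0}` (no condition at `T`), where `u(0)` is
the value at `0` of the representative of `u` that is continuous on `[0, T]`. -/
def H10 (T : ℝ) (E : Type*) [NormedAddCommGroup E] [NormedSpace ℝ E] :
    Submodule ℝ (L2Pair E T) where
  carrier := {w | w ∈ H1 T E ∧ ∃ c : ℝ → E, ContinuousOn c (Icc 0 T) ∧
    (w.fst : ℝ → E) =ᵐ[timeMeasure T] c ∧ c 0 = 0}
  zero_mem' := ⟨(H1 T E).zero_mem, 0, continuousOn_const, Lp.coeFn_zero E 2 _, rfl⟩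
  add_mem' := by
    rintro a b ⟨ha, c, hc, hac, h0⟩ ⟨hb, d, hd, hbd, h0'⟩
    exact ⟨(H1 T E).add_mem ha hb, c + d, hc.add hd,
      (Lp.coeFn_add a.fst b.fst).trans (hac.add hbd), by simp [h0, h0']⟩
  smul_mem' := by
    rintro r a ⟨ha, c, hc, hac, h0⟩
    exact ⟨(H1 T E).smul_mem r ha, r • c, hc.const_smul r,
      (Lp.coeFn_smul r a.fst).trans (hac.const_smul r), by simp [h0]⟩

section Convergence

variable {E : Type*} [NormedAddCommGroup E] [NormedSpace ℝ E]

/-- A representative of the function underlying an element of `H¹₀(0, T; E)`. -/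
def value {T : ℝ} (u : H10 T E) : ℝ → E := ((u : L2Pair E T).fst : ℝ → E)

/-- A representative of the weak derivative of an element of `H¹₀(0, T; E)`. -/
def rate {T : ℝ} (u : H10 T E) : ℝ → E := ((u : L2Pair E T).snd : ℝ → E)

/-- Weak convergence `x_m ⇀ x` of a sequence in a normed space. -/
def WeaklyConverges (x : ℕ → E) (x₀ : E) : Prop :=
  ∀ f : StrongDual ℝ E, Tendsto (fun m => f (x m)) atTop (𝓝 (f x₀))

/-- (Sequential) weak lower semicontinuity of a real functional: `x_m ⇀ x` implies
`j x ≤ liminf j (x_m)`. -/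
def WeaklyLSC (j : E → ℝ) : Prop :=
  ∀ (x : ℕ → E) (x₀ : E), WeaklyConverges x x₀ →
    (j x₀ : EReal) ≤ liminf (fun m => (j (x m) : EReal)) atTop

end Convergence

/-- Reflexivity: the canonical map into the bidual is onto. -/
def IsReflexive (E : Type*) [NormedAddCommGroup E] [NormedSpace ℝ E] : Prop :=
  Function.Surjective (NormedSpace.inclusionInDoubleDual ℝ E)

/-! ### The history-dependent rate-independent system -/

section RIS

variable {X Y Z : Type*} [NormedAddCommGroup X] [NormedSpace ℝ X]
  [NormedAddCommGroup Y] [InnerProductSpace ℝ Y]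
  [NormedAddCommGroup Z] [NormedSpace ℝ Z]

/-- The convex subdifferential of `f` at `y`. -/
def subdifferential (f : Y → EReal) (y : Y) : Set (StrongDual ℝ Y) :=
  {φ | ∀ v : Y, f y + (φ (v - y) : EReal) ≤ f v}

/-- The quadratic energy `ℰ(t, q) = ½ (A q, q) - ⟨ℓ(t), q⟩` for the load `ℓ`. -/
def energy (A : Y →L[ℝ] Y) (ℓ : ℝ → StrongDual ℝ Y) (t : ℝ) (q : Y) : ℝ :=
  1 / 2 * inner ℝ (A q) q - ℓ t q

/-- The history operator `ℋ(y)(t) = ∫₀ᵗ B(t - s) y(s) ds + y₀`. -/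
def history (B : ℝ → Y →L[ℝ] X) (y₀ : X) (y : ℝ → Y) (t : ℝ) : X :=
  (∫ s in (0 : ℝ)..t, B (t - s) (y s)) + y₀

/-- The effective domain of `ℛ(ζ, ·)`. -/
def effDom (R : X → Y → ℝ≥0∞) (ζ : X) : Set Y := {η | R ζ η < ⊤}

/-- The common effective domain `dom ℛ`; under `IsDissipation` below `effDom R ζ` does not depend
on `ζ`, so it may be evaluated at `ζ = 0`. -/
def dom (R : X → Y → ℝ≥0∞) : Set Y := effDom R 0

/-- Standing requirements on the dissipation functional `ℛ : X × Y → [0, ∞]`. -/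
structure IsDissipation (R : X → Y → ℝ≥0∞) : Prop where
  proper : ∀ ζ, (effDom R ζ).Nonempty
  convex : ∀ ζ, ConvexOn ℝ≥0 univ (R ζ)
  lsc : ∀ ζ, LowerSemicontinuous (R ζ)
  homogeneous : ∀ ζ (γ : ℝ≥0) (η : Y), R ζ (γ • η) = γ * R ζ η
  dom_indep : ∀ ζ₁ ζ₂, effDom R ζ₁ = effDom R ζ₂
  lipschitz : ∃ L : ℝ, 0 ≤ L ∧ ∀ ζ₁ ζ₂ : X, ∀ η₁ ∈ dom R, ∀ η₂ ∈ dom R,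
    (R ζ₁ η₂).toReal - (R ζ₁ η₁).toReal + (R ζ₂ η₁).toReal - (R ζ₂ η₂).toReal
      ≤ L * ‖ζ₁ - ζ₂‖ * ‖η₁ - η₂‖

/-- `𝒴 = {y ∈ H¹₀(0,T;Y) : y'(t) ∈ dom ℛ for a.a. t}`. -/
def admissibleRates (T : ℝ) (R : X → Y → ℝ≥0∞) : Set (H10 T Y) :=
  {y | ∀ᵐ t ∂(timeMeasure T), rate y t ∈ dom R}

/-- `∫₀ᵀ ℛ(ℋ(y)(t), v'(t)) dt ∈ [0, ∞]`. -/
def totalDissipation {T : ℝ} (R : X → Y → ℝ≥0∞) (B : ℝ → Y →L[ℝ] X) (y₀ : X)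
    (y v : H10 T Y) : ℝ≥0∞ :=
  ∫⁻ t, R (history B y₀ (value y) t) (rate v t) ∂(timeMeasure T)

/-- `dom ℛ` is closed, and along weakly convergent sequences in `𝒴` the dissipation satisfies a
liminf inequality and admits recovery sequences. -/
def DissipationConvergence (T : ℝ) (R : X → Y → ℝ≥0∞) (B : ℝ → Y →L[ℝ] X) (y₀ : X) : Prop :=
  IsClosed (dom R) ∧
  ∀ (y : ℕ → H10 T Y) (y' : H10 T Y), (∀ m, y m ∈ admissibleRates T R) → WeaklyConverges y y' →
    totalDissipation R B y₀ y' y' ≤ liminf (fun m => totalDissipation R B y₀ (y m) (y m)) atTop ∧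
    ∀ v ∈ admissibleRates T R, ∃ w : ℕ → H10 T Y, (∀ m, w m ∈ admissibleRates T R) ∧
      Tendsto w atTop (𝓝 v) ∧
      limsup (fun m => totalDissipation R B y₀ (y m) (w m)) atTop ≤ totalDissipation R B y₀ y' v

/-- `q` solves, for the load `ℓ`, the differential inclusion
`-∂_q ℰ(t, q(t)) ∈ ∂₂ ℛ(ℋ(q)(t), q'(t))` for a.a. `t ∈ (0,T)`. The initial condition `q(0) = 0` is
part of `q ∈ H¹₀(0,T;Y)`. -/
def Solves {T : ℝ} (A : Y →L[ℝ] Y) (R : X → Y → ℝ≥0∞) (B : ℝ → Y →L[ℝ] X) (y₀ : X)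
    (ℓ : ℝ → StrongDual ℝ Y) (q : H10 T Y) : Prop :=
  ∀ᵐ t ∂(timeMeasure T),
    -fderiv ℝ (energy A ℓ t) (value q t) ∈
      subdifferential (fun η => (R (history B y₀ (value q) t) η : EReal)) (rate q t)

/-- The admissible pairs `(ℓ, q)`: `q` solves the system with the load `ℓ`, viewed as a
`Y*`-valued function through the embedding `ι : Z → Y*`. -/
def admissiblePairs (T : ℝ) (ι : Z →L[ℝ] StrongDual ℝ Y) (A : Y →L[ℝ] Y) (R : X → Y → ℝ≥0∞)
    (B : ℝ → Y →L[ℝ] X) (y₀ : X) : Set (H10 T Z × H10 T Y) :=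
  {p | Solves A R B y₀ (fun t => ι (value p.1 t)) p.2}

/-- The objective `j(q) + ½ ‖ℓ‖²_{H¹(0,T;Z)}`. -/
def objective {T : ℝ} (j : H10 T Y → ℝ) (p : H10 T Z × H10 T Y) : ℝ :=
  j p.2 + 1 / 2 * ‖p.1‖ ^ 2

end RIS

end HistoryRIS

end

/-! The proof is the direct method of the calculus of variations, carried out on weak derivatives:
`ofRate` identifies `H¹₀(0, T; E)` with `L²(0, T; E)` by integration from `0`
(`value_ae_eq_primitive`, a vector-valued du Bois-Reymond lemma), and `Y*` is identified with `Y`, so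
that the embedding becomes a compact injective operator `κ : Z → Y`.

Since `R(ζ, ·)` is positively homogeneous, the differential inclusion splits into the stability
inequality `⟪σ(t), ·⟫ ≤ R(ℋ(q)(t), ·)` for the driving force `σ = κ ℓ - A q` and the energy balance
`R(ℋ(q)(t), q'(t)) = ⟪σ(t), q'(t)⟫` (`mem_admissiblePairs_iff`). Both `σ` and `ℋ(q)` are continuous
in time and `R` is Lipschitz in its first argument, so stability holds at every time, not only almost
everywhere.

*A priori bound.* Comparing stability at `s < t` with the balance at `t` and letting `s ↑ t` gives
`α ‖q'(t)‖ ≤ ‖κ ℓ'(t)‖ + L ‖B‖_∞ ∫₀ᵗ ‖q'‖`, since the history operator is Lipschitz in time with a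
constant controlled by `∫₀ᵗ ‖q'‖` (`norm_rateHistory_sub_le`). Gronwall's inequality then bounds `q'`
in `L²` in terms of `ℓ'` (`exists_norm_rate_le`), so minimizing sequences are bounded.

*Compactness.* The rates `q_n'` and `κ ℓ_n'` have weakly convergent subsequences in the Hilbert space
`L²(0, T; Y)`. The weak limit of `κ ℓ_n'` is again of the form `κ ℓ'`, with `ℓ` satisfying the lower
semicontinuity of the norm. This is `IsReflexive.exists_rate_of_weaklyConverges`, which avoids the
reflexivity of `L²(0, T; Z)`: by Mazur's lemma it suffices to treat strong limits, these are attained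
pointwise because `Z` is reflexive, measurability of the limit follows from the Lusin–Souslin theorem,
and the norm is controlled by Fatou's lemma. Because `κ` is compact, `κ ℓ_n → κ ℓ` strongly in `L²`.

*Closedness.* Integrated stability passes to the limit along recovery sequences, as a weakly
convergent sequence `σ_n` paired with strongly convergent test rates, and localises again
(`stable_of_inner_le_totalDissipation`). In the energy balance the term `∫ ⟪A q_n, q_n'⟫` is a
nonnegative quadratic form in `q_n'`, hence weakly lower semicontinuous (`inner_volterra_nonneg`), so
the energy inequality survives. Together with stability it is an equality almost everywhere
(`IsEnergeticSolution.of_weaklyConverges`). Weak lower semicontinuity of `j` and of the norm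
concludes. -/

namespace HistoryRIS

/-! ### Primitives of integrable functions on a time interval -/

section Primitive

variable {E F : Type*} [NormedAddCommGroup E] [NormedSpace ℝ E]
  [NormedAddCommGroup F] [NormedSpace ℝ F] {T : ℝ}

/-- The primitive `t ↦ ∫₀ᵗ g` of a function `g` on `(0, T)`, where `g` is extended by zero to the
whole line. In particular the primitive vanishes on `(-∞, 0]`. -/
noncomputable def primitive (T : ℝ) (g : ℝ → E) (t : ℝ) : E :=
  ∫ s in (0 : ℝ)..t, (Ioo 0 T).indicator g s

theorem integrable_indicator_Ioo {G : Type*} [NormedAddCommGroup G] {g : ℝ → G} (hg : Integrable g (timeMeasure T)) :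
    Integrable ((Ioo 0 T).indicator g) volume :=
  (integrable_indicator_iff measurableSet_Ioo).2 hg

theorem intervalIntegrable_indicator_Ioo {G : Type*} [NormedAddCommGroup G] {g : ℝ → G}
    (hg : Integrable g (timeMeasure T))
    (a b : ℝ) :
    IntervalIntegrable ((Ioo 0 T).indicator g) volume a b :=
  (integrable_indicator_Ioo hg).intervalIntegrable

theorem primitive_congr {g h : ℝ → E} (hgh : g =ᵐ[timeMeasure T] h) :
    primitive T g = primitive T h := by
  funext t
  refine intervalIntegral.integral_congr_ae ?_
  have h1 := (ae_restrict_iff' measurableSet_Ioo).1 hgh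
  filter_upwards [h1] with s hs _
  by_cases h2 : s ∈ Ioo 0 T
  · simp [h2, hs h2]
  · simp [h2]

theorem continuous_primitive {g : ℝ → E} (hg : Integrable g (timeMeasure T)) :
    Continuous (primitive T g) :=
  intervalIntegral.continuous_primitive (intervalIntegrable_indicator_Ioo hg) 0

theorem primitive_of_nonpos (g : ℝ → E) {t : ℝ} (ht : t ≤ 0) : primitive T g t = 0 := by
  unfold primitive
  rw [intervalIntegral.integral_of_ge ht, neg_eq_zero]
  refine setIntegral_eq_zero_of_forall_eq_zero fun s hs => ?_
  simp [hs.2]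

@[simp]
theorem primitive_at_zero (g : ℝ → E) : primitive T g 0 = 0 := primitive_of_nonpos g le_rfl

theorem primitive_sub_primitive {g : ℝ → E} (hg : Integrable g (timeMeasure T)) (s t : ℝ) :
    primitive T g t - primitive T g s = ∫ r in s..t, (Ioo 0 T).indicator g r :=
  intervalIntegral.integral_interval_sub_left (intervalIntegrable_indicator_Ioo hg _ _)
    (intervalIntegrable_indicator_Ioo hg _ _)

theorem norm_primitive_sub_le {g : ℝ → E} (hg : Integrable g (timeMeasure T)) {s t : ℝ}
    (hst : s ≤ t) : ‖primitive T g t - primitive T g s‖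
      ≤ primitive T (fun r => ‖g r‖) t - primitive T (fun r => ‖g r‖) s := by
  rw [primitive_sub_primitive hg, primitive_sub_primitive hg.norm]
  refine (intervalIntegral.norm_integral_le_integral_norm hst).trans (le_of_eq ?_)
  simp only [norm_indicator_eq_indicator_norm]

theorem primitive_norm_mono {g : ℝ → E} (hg : Integrable g (timeMeasure T)) :
    Monotone (primitive T (fun r => ‖g r‖)) := fun _ _ hst =>
  sub_nonneg.1 ((norm_nonneg _).trans (norm_primitive_sub_le hg hst))

theorem primitive_norm_nonneg {g : ℝ → E} (hg : Integrable g (timeMeasure T)) (t : ℝ) :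
    0 ≤ primitive T (fun r => ‖g r‖) t := by
  rcases le_total t 0 with h | h
  · rw [primitive_of_nonpos _ h]
  · simpa using primitive_norm_mono hg h

theorem primitive_eq_setIntegral (g : ℝ → E) {t : ℝ} (ht : t ∈ Icc 0 T) :
    primitive T g t = ∫ s, (Iio t).indicator g s ∂(timeMeasure T) := by
  unfold primitive
  rw [intervalIntegral.integral_of_le ht.1, integral_Ioc_eq_integral_Ioo,
    integral_indicator measurableSet_Iio, timeMeasure, Measure.restrict_restrict measurableSet_Iio,
    setIntegral_indicator measurableSet_Ioo]
  congr 2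
  ext s
  simp only [mem_inter_iff, mem_Ioo, mem_Iio]
  have := ht.2
  grind

theorem primitive_norm_le {G : Type*} [NormedAddCommGroup G] {g : ℝ → G}
    (hg : Integrable g (timeMeasure T)) (t : ℝ) :
    primitive T (fun r => ‖g r‖) t ≤ ∫ s, ‖g s‖ ∂(timeMeasure T) := by
  rcases le_total t 0 with h | h
  · rw [primitive_of_nonpos _ h]
    exact integral_nonneg fun _ => norm_nonneg _
  · unfold primitive
    rw [intervalIntegral.integral_of_le h, ← integral_indicator measurableSet_Ioo]
    exact setIntegral_le_integral (integrable_indicator_Ioo hg.norm)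
      (ae_of_all _ fun s => indicator_nonneg (fun _ _ => norm_nonneg _) s)

theorem norm_primitive_le {g : ℝ → E} (hg : Integrable g (timeMeasure T)) (t : ℝ) :
    ‖primitive T g t‖ ≤ ∫ s, ‖g s‖ ∂(timeMeasure T) := by
  rcases le_total t 0 with h | h
  · rw [primitive_of_nonpos _ h, norm_zero]
    exact integral_nonneg fun _ => norm_nonneg _
  · simpa using (norm_primitive_sub_le hg h).trans
      (by simpa using primitive_norm_le hg t)

theorem primitive_clm [CompleteSpace E] [CompleteSpace F] (L : E →L[ℝ] F) {g : ℝ → E}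
    (hg : Integrable g (timeMeasure T)) (t : ℝ) :
    primitive T (fun s => L (g s)) t = L (primitive T g t) := by
  unfold primitive
  rw [← L.intervalIntegral_comp_comm (intervalIntegrable_indicator_Ioo hg _ _)]
  congr 1
  funext s
  by_cases hs : s ∈ Ioo 0 T <;> simp [hs]

theorem primitive_add {g h : ℝ → E} (hg : Integrable g (timeMeasure T))
    (hh : Integrable h (timeMeasure T)) (t : ℝ) :
    primitive T (g + h) t = primitive T g t + primitive T h t := by
  unfold primitive
  rw [← intervalIntegral.integral_add (intervalIntegrable_indicator_Ioo hg _ _)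
    (intervalIntegrable_indicator_Ioo hh _ _), indicator_add']
  rfl

theorem primitive_smul (c : ℝ) (g : ℝ → E) (t : ℝ) :
    primitive T (c • g) t = c • primitive T g t := by
  unfold primitive
  rw [← intervalIntegral.integral_smul]
  congr 1
  funext s
  by_cases hs : s ∈ Ioo 0 T <;> simp [hs]

theorem ae_hasDerivAt_primitive [CompleteSpace E] {g : ℝ → E}
    (hg : Integrable g (timeMeasure T)) :
    ∀ᵐ t ∂(timeMeasure T), HasDerivAt (primitive T g) (g t) t := by
  have h := (intervalIntegrable_indicator_Ioo hg 0 T).ae_hasDerivAt_integral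
  refine (ae_restrict_iff' measurableSet_Ioo).2 ?_
  filter_upwards [h] with t ht hmem
  have hT : (0 : ℝ) ≤ T := (hmem.1.trans hmem.2).le
  have := ht (by rw [uIcc_of_le hT]; exact Ioo_subset_Icc_self hmem) 0 left_mem_uIcc
  rwa [indicator_of_mem hmem] at this

/-- The exchange of the order of integration behind integration by parts: the primitive of an
integrable function has that function as its weak derivative. -/
theorem hasWeakDeriv_primitive [CompleteSpace E] {g : ℝ → E} (hg : Integrable g (timeMeasure T)) :
    HasWeakDeriv T (primitive T g) g := by
  intro φ hφ hc hs
  have hd : Continuous (deriv φ) := hφ.continuous_deriv (by norm_num)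
  have hdi : Integrable (deriv φ) (timeMeasure T) :=
    (hd.integrable_of_hasCompactSupport hc.deriv).restrict
  have hprod : Integrable (Function.uncurry fun t s => (Iio t).indicator
      (fun s => deriv φ t • g s) s) ((timeMeasure T).prod (timeMeasure T)) := by
    have h1 : Integrable (fun z : ℝ × ℝ => deriv φ z.1 • g z.2)
      ((timeMeasure T).prod (timeMeasure T)) := hdi.smul_prod hg
    have h2 : MeasurableSet {z : ℝ × ℝ | z.2 < z.1} :=
      measurableSet_lt measurable_snd measurable_fst
    refine (h1.indicator h2).congr (ae_of_all _ fun z => ?_)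
    by_cases hz : z.2 < z.1 <;> simp [Function.uncurry, indicator, hz]
  have hswap := integral_integral_swap hprod
  calc ∫ t, deriv φ t • primitive T g t ∂(timeMeasure T)
      = ∫ t, ∫ s, (Iio t).indicator (fun s => deriv φ t • g s) s
          ∂(timeMeasure T) ∂(timeMeasure T) := by
        refine integral_congr_ae ((ae_restrict_iff' measurableSet_Ioo).2
          (ae_of_all _ fun t ht => ?_))
        dsimp only
        rw [primitive_eq_setIntegral g (Ioo_subset_Icc_self ht), ← integral_smul]
        congr 1
        funext s
        by_cases hz : s < t <;> simp [indicator, hz]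
    _ = ∫ s, ∫ t, (Iio t).indicator (fun s => deriv φ t • g s) s
          ∂(timeMeasure T) ∂(timeMeasure T) := hswap
    _ = ∫ s, -(φ s • g s) ∂(timeMeasure T) := by
        refine integral_congr_ae ((ae_restrict_iff' measurableSet_Ioo).2
          (ae_of_all _ fun s hs' => ?_))
        dsimp only
        have h3 : (fun t => (Iio t).indicator (fun s => deriv φ t • g s) s)
            = fun t => ((Ioi s).indicator (deriv φ) t) • g s := by
          funext t
          by_cases hz : s < t <;> simp [indicator, hz]
        rw [h3, integral_smul_const, integral_indicator measurableSet_Ioi, timeMeasure,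
          Measure.restrict_restrict measurableSet_Ioi, ← neg_smul]
        congr 1
        have h4 : Ioi s ∩ Ioo 0 T = Ioo s T := by
          ext r
          simp only [mem_inter_iff, mem_Ioi, mem_Ioo]
          have := hs'.1
          grind
        rw [h4, ← integral_Ioc_eq_integral_Ioo, ← intervalIntegral.integral_of_le hs'.2.le,
          intervalIntegral.integral_deriv_eq_sub'  φ rfl
            (fun x _ => (hφ.differentiable (by norm_num)).differentiableAt) hd.continuousOn,
          image_eq_zero_of_notMem_tsupport (fun h => lt_irrefl T (hs h).2), zero_sub]
    _ = -∫ s, φ s • g s ∂(timeMeasure T) := integral_neg _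

theorem exists_test_integral_eq_one (hT : 0 < T) : ∃ ρ : ℝ → ℝ, ContDiff ℝ ∞ ρ ∧
    HasCompactSupport ρ ∧ tsupport ρ ⊆ Ioo 0 T ∧ ∫ t, ρ t ∂(timeMeasure T) = 1 := by
  let f : ContDiffBump (T / 2) := ⟨T / 8, T / 4, by positivity, by linarith⟩
  have hts : tsupport (f.normed volume) ⊆ Ioo 0 T := by
    rw [f.tsupport_normed_eq, Real.closedBall_eq_Icc]
    change Icc (T / 2 - T / 4) (T / 2 + T / 4) ⊆ Ioo 0 T
    intro x hx
    exact ⟨by linarith [hx.1], by linarith [hx.2]⟩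
  refine ⟨f.normed volume, f.contDiff_normed, f.hasCompactSupport_normed, hts, ?_⟩
  rw [← f.integral_normed (μ := volume)]
  exact setIntegral_eq_integral_of_forall_compl_eq_zero fun x hx =>
    image_eq_zero_of_notMem_tsupport fun h => hx (hts h)

/-- A test function of mean zero is the derivative of a test function. -/
theorem exists_test_deriv_eq {φ : ℝ → ℝ} (hφ : ContDiff ℝ ∞ φ)
    (hc : HasCompactSupport φ) (hs : tsupport φ ⊆ Ioo 0 T)
    (h0 : ∫ t, φ t ∂(timeMeasure T) = 0) : ∃ ψ : ℝ → ℝ, ContDiff ℝ ∞ ψ ∧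
      HasCompactSupport ψ ∧ tsupport ψ ⊆ Ioo 0 T ∧ deriv ψ = φ := by
  have hcont : Continuous φ := hφ.continuous
  have hder : ∀ t, HasDerivAt (fun t => ∫ s in (0 : ℝ)..t, φ s) (φ t) t := fun t =>
    intervalIntegral.integral_hasDerivAt_right (hcont.intervalIntegrable _ _)
      (hcont.stronglyMeasurableAtFilter _ _) hcont.continuousAt
  have hderiv : deriv (fun t => ∫ s in (0 : ℝ)..t, φ s) = φ := funext fun t => (hder t).deriv
  have hzero : ∀ t, t ∉ Ioo 0 T → φ t = 0 := fun t ht =>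
    image_eq_zero_of_notMem_tsupport fun h => ht (hs h)
  by_cases hne : (tsupport φ).Nonempty
  · obtain ⟨a, ha, ha'⟩ := hc.isCompact.exists_isLeast hne
    obtain ⟨b, hb, hb'⟩ := hc.isCompact.exists_isGreatest hne
    have hab : a ≤ b := ha' hb
    have hsub : Icc a b ⊆ Ioo 0 T := fun x hx =>
      ⟨(hs ha).1.trans_le hx.1, hx.2.trans_lt (hs hb).2⟩
    have hout : ∀ t, t ∉ Icc a b → φ t = 0 := fun t ht =>
      image_eq_zero_of_notMem_tsupport fun h => ht ⟨ha' h, hb' h⟩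
    have htot : ∫ s, φ s = 0 := by
      rw [← h0]
      exact (setIntegral_eq_integral_of_forall_compl_eq_zero hzero).symm
    have hsupp : ∀ t, t ∉ Icc a b → ∫ s in (0 : ℝ)..t, φ s = 0 := by
      intro t ht
      have hi : Integrable φ := hcont.integrable_of_hasCompactSupport hc
      have e0 : ∫ s in Iic (0 : ℝ), φ s = 0 :=
        setIntegral_eq_zero_of_forall_eq_zero fun s hs' => hzero s fun h => not_lt.2 hs' h.1
      have e1 : ∫ s in (0 : ℝ)..t, φ s = ∫ s in Iic t, φ s := by
        rw [← intervalIntegral.integral_Iic_sub_Iic hi.integrableOn hi.integrableOn, e0, sub_zero]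
      rw [e1]
      rcases lt_or_ge t a with h | h
      · exact setIntegral_eq_zero_of_forall_eq_zero fun s hs' =>
          hout s fun h' => not_lt.2 (h'.1.trans hs') h
      · rw [← htot]
        exact setIntegral_eq_integral_of_forall_compl_eq_zero fun s hs' =>
          hout s fun h' => ht ⟨h, (not_le.1 hs').le.trans h'.2⟩
    have hsub2 : tsupport (fun t => ∫ s in (0 : ℝ)..t, φ s) ⊆ Icc a b :=
      closure_minimal (fun t ht => by_contra fun h => ht (hsupp t h)) isClosed_Icc
    refine ⟨_, ?_, isCompact_Icc.of_isClosed_subset (isClosed_tsupport _) hsub2, hsub2.trans hsub, hderiv⟩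
    refine contDiff_infty_iff_deriv.2 ⟨fun t => (hder t).differentiableAt, ?_⟩
    rwa [hderiv]
  · have : φ = 0 := by
      rw [not_nonempty_iff_eq_empty, tsupport_eq_empty_iff] at hne
      exact hne
    exact ⟨0, contDiff_const, HasCompactSupport.zero, by simp, by rw [this]; exact deriv_const' 0⟩

/-- Du Bois-Reymond: an integrable function with an integrable weak derivative is, up to an
additive constant, the primitive of that derivative. -/
theorem HasWeakDeriv.exists_ae_eq_add_primitive [CompleteSpace E] (hT : 0 < T) {u g : ℝ → E}
    (hu : Integrable u (timeMeasure T)) (hg : Integrable g (timeMeasure T))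
    (h : HasWeakDeriv T u g) : ∃ c : E, u =ᵐ[timeMeasure T] fun t => c + primitive T g t := by
  obtain ⟨ρ, hρ, hρc, hρs, hρ1⟩ := exists_test_integral_eq_one hT
  have hw : Integrable (primitive T g) (timeMeasure T) :=
    ((continuous_primitive hg).integrableOn_Icc).mono_set Ioo_subset_Icc_self
  set d : ℝ → E := fun t => u t - primitive T g t with hd
  have hdi : Integrable d (timeMeasure T) := hu.sub hw
  have hti : ∀ {ψ : ℝ → ℝ} {f : ℝ → E}, Continuous ψ → HasCompactSupport ψ →
      Integrable f (timeMeasure T) → Integrable (fun t => ψ t • f t) (timeMeasure T) := by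
    intro ψ f hψ hc hf
    obtain ⟨C, hC⟩ := hc.exists_bound_of_continuous hψ
    exact hf.bdd_smul C hψ.aestronglyMeasurable (ae_of_all _ hC)
  have hd0 : ∀ ψ : ℝ → ℝ, ContDiff ℝ ∞ ψ → HasCompactSupport ψ → tsupport ψ ⊆ Ioo 0 T →
      ∫ t, deriv ψ t • d t ∂(timeMeasure T) = 0 := by
    intro ψ h1 h2 h3
    have hdc := h1.continuous_deriv (by norm_num)
    simp only [hd, smul_sub]
    rw [integral_sub (hti hdc h2.deriv hu) (hti hdc h2.deriv hw), h ψ h1 h2 h3,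
      hasWeakDeriv_primitive hg ψ h1 h2 h3, sub_self]
  set c : E := ∫ t, ρ t • d t ∂(timeMeasure T) with hcdef
  refine ⟨c, ?_⟩
  have hci : Integrable (fun t => d t - c) (timeMeasure T) := hdi.sub (integrable_const c)
  have key : ∀ᵐ t ∂(volume : Measure ℝ), t ∈ Ioo 0 T → d t - c = 0 := by
    refine isOpen_Ioo.ae_eq_zero_of_integral_contDiff_smul_eq_zero
      (f := fun t => d t - c) (IntegrableOn.locallyIntegrableOn hci) ?_
    intro φ h1 h2 h3
    have e : ∫ t, φ t • (d t - c) = ∫ t, φ t • (d t - c) ∂(timeMeasure T) :=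
      (setIntegral_eq_integral_of_forall_compl_eq_zero fun t ht => by
        rw [image_eq_zero_of_notMem_tsupport fun h' => ht (h3 h'), zero_smul]).symm
    have hφi : Integrable φ (timeMeasure T) :=
      (h1.continuous.integrable_of_hasCompactSupport h2).restrict
    have hρi : Integrable ρ (timeMeasure T) :=
      (hρ.continuous.integrable_of_hasCompactSupport hρc).restrict
    set m : ℝ := ∫ t, φ t ∂(timeMeasure T) with hm
    obtain ⟨ψ, hψ1, hψ2, hψ3, hψ4⟩ := exists_test_deriv_eq (T := T) (φ := fun t => φ t - m * ρ t)
      (h1.sub (contDiff_const.mul hρ)) (h2.sub hρc.mul_left)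
      ((tsupport_sub _ _).trans (union_subset h3 ((tsupport_mul_subset_right).trans hρs)))
      (by rw [integral_sub hφi (hρi.const_mul m), integral_const_mul, hρ1, mul_one, sub_self])
    have h5 := hd0 ψ hψ1 hψ2 hψ3
    simp only [hψ4, sub_smul, mul_smul] at h5
    have h6 : Integrable (fun t => m • ρ t • d t) (timeMeasure T) :=
      (hti hρ.continuous hρc hdi).smul m
    rw [integral_sub (hti h1.continuous h2 hdi) h6, integral_smul, ← hcdef] at h5
    rw [e]
    simp only [smul_sub]
    rw [integral_sub (hti h1.continuous h2 hdi) (hti h1.continuous h2 (integrable_const c)),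
      integral_smul_const, h5]
  refine (ae_restrict_iff' measurableSet_Ioo).2 ?_
  filter_upwards [key] with t ht hmem
  have := ht hmem
  simp only [hd] at this
  rw [← sub_eq_zero, ← this]
  abel

/-- `W^{1,1}(0, T; E)` embeds into `L^∞(0, T; E)`. -/
theorem MemW11.exists_ae_norm_le [CompleteSpace E] (hT : 0 < T) {B : ℝ → E} (hB : MemW11 T B) :
    ∃ C : ℝ, 0 ≤ C ∧ ∀ᵐ t ∂(timeMeasure T), ‖B t‖ ≤ C := by
  obtain ⟨hi, B', hB', hw⟩ := hB
  obtain ⟨c, hc⟩ := hw.exists_ae_eq_add_primitive hT hi hB'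
  refine ⟨‖c‖ + ∫ s, ‖B' s‖ ∂(timeMeasure T), by positivity, ?_⟩
  filter_upwards [hc] with t ht
  rw [ht]
  exact (norm_add_le _ _).trans (by gcongr; exact norm_primitive_le hB' t)

end Primitive

/-! ### The space `H¹₀` as a copy of `L²` -/

section RateParametrization

variable {E : Type*} [NormedAddCommGroup E] [NormedSpace ℝ E]
  {T : ℝ}

theorem integrable_coeFn {G : Type*} [NormedAddCommGroup G] (g : Lp G 2 (timeMeasure T)) :
    Integrable (g : ℝ → G) (timeMeasure T) :=
  (Lp.memLp g).integrable (by norm_num)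

theorem exists_integral_norm_le (T : ℝ) : ∃ K : ℝ, 0 ≤ K ∧
    ∀ {G : Type*} [NormedAddCommGroup G] (g : Lp G 2 (timeMeasure T)),
      ∫ s, ‖g s‖ ∂(timeMeasure T) ≤ K * ‖g‖ := by
  refine ⟨((timeMeasure T) univ ^ (1 / (1 : ℝ≥0∞).toReal - 1 / (2 : ℝ≥0∞).toReal)).toReal,
    ENNReal.toReal_nonneg, fun g => ?_⟩
  have h := eLpNorm_le_eLpNorm_mul_rpow_measure_univ (μ := timeMeasure T) (p := 1) (q := 2)
    (by norm_num) (Lp.aestronglyMeasurable g)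
  rw [Lp.norm_def, ← ENNReal.toReal_mul, integral_norm_eq_lintegral_enorm
    (Lp.aestronglyMeasurable g), ← eLpNorm_one_eq_lintegral_enorm, mul_comm]
  refine ENNReal.toReal_mono (ENNReal.mul_ne_top (Lp.eLpNorm_ne_top g) ?_) h
  exact ENNReal.rpow_ne_top_of_nonneg (by norm_num) (measure_ne_top _ _)

theorem memLp_primitive {g : ℝ → E} (hg : Integrable g (timeMeasure T)) :
    MemLp (primitive T g) 2 (timeMeasure T) :=
  MemLp.of_bound (continuous_primitive hg).aestronglyMeasurable _
    (ae_of_all _ (norm_primitive_le hg))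

/-- Evaluation at time `t` of the primitive, as a continuous linear map on `L²(0, T; E)`. -/
noncomputable def primitiveAt (E : Type*) [NormedAddCommGroup E] [NormedSpace ℝ E] (T t : ℝ) :
    Lp E 2 (timeMeasure T) →L[ℝ] E :=
  LinearMap.mkContinuousOfExistsBound
    { toFun := fun g => primitive T g t
      map_add' := fun g h => by
        rw [primitive_congr (Lp.coeFn_add g h),
          primitive_add (integrable_coeFn g) (integrable_coeFn h)]
      map_smul' := fun c g => by
        rw [primitive_congr (Lp.coeFn_smul c g), primitive_smul]; rfl }
    (by
      obtain ⟨K, _, hK⟩ := exists_integral_norm_le T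
      exact ⟨K, fun g => (norm_primitive_le (integrable_coeFn g) t).trans (hK g)⟩)

theorem primitiveAt_apply (t : ℝ) (g : Lp E 2 (timeMeasure T)) :
    primitiveAt E T t g = primitive T g t := rfl

/-- The Volterra operator `g ↦ (t ↦ ∫₀ᵗ g)` on `L²(0, T; E)`. -/
noncomputable def volterra (E : Type*) [NormedAddCommGroup E] [NormedSpace ℝ E] (T : ℝ) :
    Lp E 2 (timeMeasure T) →L[ℝ] Lp E 2 (timeMeasure T) :=
  LinearMap.mkContinuousOfExistsBound
    { toFun := fun g => (memLp_primitive (integrable_coeFn g)).toLp _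
      map_add' := fun g h => by
        rw [← MemLp.toLp_add]
        refine MemLp.toLp_congr _ _ (ae_of_all _ fun t => ?_)
        exact (primitiveAt E T t).map_add g h
      map_smul' := fun c g => by
        rw [RingHom.id_apply, ← MemLp.toLp_const_smul]
        refine MemLp.toLp_congr _ _ (ae_of_all _ fun t => ?_)
        exact (primitiveAt E T t).map_smul c g }
    (by
      obtain ⟨K, hK0, hK⟩ := exists_integral_norm_le T
      refine ⟨(measureUnivNNReal (timeMeasure T) : ℝ) ^ (2 : ℝ≥0∞).toReal⁻¹ * K, fun g => ?_⟩
      rw [mul_assoc]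
      refine Lp.norm_le_of_ae_bound (by positivity) ?_
      filter_upwards [MemLp.coeFn_toLp (memLp_primitive (integrable_coeFn g))] with t ht
      refine (congrArg norm ht).trans_le ?_
      exact (norm_primitive_le (integrable_coeFn g) t).trans (hK g))

theorem coeFn_volterra (g : Lp E 2 (timeMeasure T)) :
    volterra E T g =ᵐ[timeMeasure T] primitive T g :=
  MemLp.coeFn_toLp (memLp_primitive (integrable_coeFn g))

theorem HasWeakDeriv.congr_left {u v g : ℝ → E} (h : HasWeakDeriv T u g)
    (huv : u =ᵐ[timeMeasure T] v) : HasWeakDeriv T v g := by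
  intro φ h1 h2 h3
  rw [← h φ h1 h2 h3]
  refine integral_congr_ae ?_
  filter_upwards [huv] with t ht
  rw [ht]

/-- The element of `H¹₀(0, T; E)` with a prescribed weak derivative in `L²(0, T; E)`. By
`ofRate_snd` this is an isomorphism of `L²(0, T; E)` onto `H¹₀(0, T; E)`. -/
noncomputable def ofRate (E : Type*) [NormedAddCommGroup E] [NormedSpace ℝ E] [CompleteSpace E]
    (T : ℝ) : Lp E 2 (timeMeasure T) →L[ℝ] H10 T E :=
  (((WithLp.prodContinuousLinearEquiv 2 ℝ (Lp E 2 (timeMeasure T))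
      (Lp E 2 (timeMeasure T))).symm.toContinuousLinearMap :
      (Lp E 2 (timeMeasure T) × Lp E 2 (timeMeasure T)) →L[ℝ] L2Pair E T) ∘L
    ((volterra E T).prod (ContinuousLinearMap.id ℝ _))).codRestrict (H10 T E) fun g =>
      ⟨(hasWeakDeriv_primitive (integrable_coeFn g)).congr_left (coeFn_volterra g).symm,
        primitive T g, (continuous_primitive (integrable_coeFn g)).continuousOn,
        coeFn_volterra g, primitive_at_zero _⟩

variable [CompleteSpace E]

theorem ofRate_snd_coe (g : Lp E 2 (timeMeasure T)) :
    (ofRate E T g : L2Pair E T).snd = g := rfl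

theorem rate_ofRate (g : Lp E 2 (timeMeasure T)) : rate (ofRate E T g) = g := rfl

theorem value_ofRate (g : Lp E 2 (timeMeasure T)) :
    value (ofRate E T g) =ᵐ[timeMeasure T] primitive T g := coeFn_volterra g

theorem norm_ofRate_sq (g : Lp E 2 (timeMeasure T)) :
    ‖ofRate E T g‖ ^ 2 = ‖volterra E T g‖ ^ 2 + ‖g‖ ^ 2 :=
  WithLp.prod_norm_sq_eq_of_L2 (ofRate E T g : L2Pair E T)

theorem norm_le_norm_ofRate (g : Lp E 2 (timeMeasure T)) : ‖g‖ ≤ ‖ofRate E T g‖ := by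
  refine le_of_sq_le_sq ?_ (norm_nonneg _)
  rw [norm_ofRate_sq]
  nlinarith [sq_nonneg ‖volterra E T g‖]

theorem apply_zero_eq_of_ae_eq_const {G : Type*} [TopologicalSpace G] [T2Space G] (hT : 0 < T)
    {c : ℝ → G} {a : G}
    (hc : ContinuousOn c (Icc 0 T)) (h : c =ᵐ[timeMeasure T] fun _ => a) : c 0 = a := by
  have h1 : EqOn c (fun _ => a) (Ioo 0 T) :=
    Measure.eqOn_open_of_ae_eq h isOpen_Ioo (hc.mono Ioo_subset_Icc_self) continuousOn_const
  have h2 : Tendsto c (𝓝[>] 0) (𝓝 (c 0)) := by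
    have := (hc 0 ⟨le_rfl, hT.le⟩).tendsto
    exact this.mono_left (by
      rw [nhdsWithin_le_iff]
      exact mem_of_superset (Ioo_mem_nhdsGT hT) Ioo_subset_Icc_self)
  refine tendsto_nhds_unique (h2.congr' ?_) tendsto_const_nhds
  filter_upwards [Ioo_mem_nhdsGT hT] with t ht using (h1 ht)

/-- An element of `H¹₀(0, T; E)` is the primitive of its weak derivative. -/
theorem value_ae_eq_primitive (hT : 0 < T) (u : H10 T E) :
    value u =ᵐ[timeMeasure T] primitive T (rate u) := by
  obtain ⟨⟨w, hw⟩, c, hc, hwc, hc0⟩ := u, u.2.2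
  obtain ⟨a, ha⟩ := hw.1.exists_ae_eq_add_primitive hT (integrable_coeFn w.fst)
    (integrable_coeFn w.snd)
  have h1 : (fun t => c t - primitive T w.snd t) =ᵐ[timeMeasure T] fun _ => a := by
    filter_upwards [ha, hwc] with t h1 h2
    rw [← h2]
    exact (congrArg (· - primitive T w.snd t) h1).trans (by simp)
  have h2 := apply_zero_eq_of_ae_eq_const hT
    (hc.sub (continuous_primitive (integrable_coeFn w.snd)).continuousOn) h1
  have ha0 : a = 0 := by rw [← h2]; simp [hc0]
  filter_upwards [ha] with t ht
  exact ht.trans (by rw [ha0, zero_add]; rfl)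

theorem ofRate_snd (hT : 0 < T) (u : H10 T E) : ofRate E T (u : L2Pair E T).snd = u := by
  refine Subtype.ext (WithLp.ofLp_injective 2 (Prod.ext ?_ rfl))
  exact Lp.ext ((coeFn_volterra _).trans (value_ae_eq_primitive hT u).symm)

end RateParametrization

/-! ### Weak sequential convergence -/

section WeakConvergence

variable {E F : Type*} [NormedAddCommGroup E] [NormedSpace ℝ E]
  [NormedAddCommGroup F] [NormedSpace ℝ F]

theorem WeaklyConverges.map {x : ℕ → E} {x₀ : E} (h : WeaklyConverges x x₀) (L : E →L[ℝ] F) :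
    WeaklyConverges (fun n => L (x n)) (L x₀) := fun f => h (f ∘L L)

theorem WeaklyConverges.comp {x : ℕ → E} {x₀ : E} (h : WeaklyConverges x x₀) {φ : ℕ → ℕ}
    (hφ : Tendsto φ atTop atTop) : WeaklyConverges (fun n => x (φ n)) x₀ :=
  fun f => (h f).comp hφ

/-- Mazur: closed convex sets are weakly sequentially closed. -/
theorem WeaklyConverges.mem_of_convex {x : ℕ → E} {x₀ : E} (h : WeaklyConverges x x₀)
    {C : Set E} (hC : Convex ℝ C) (hcl : IsClosed C) (hx : ∀ᶠ n in atTop, x n ∈ C) : x₀ ∈ C := by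
  by_contra hn
  obtain ⟨f, u, h1, h2⟩ := geometric_hahn_banach_closed_point hC hcl hn
  exact not_le.2 h2 (le_of_tendsto (h f) (hx.mono fun n hn => (h1 _ hn).le))

/-- Bounded sequences in a Hilbert space have weakly convergent subsequences. The sequential
Banach–Alaoglu theorem is applied in the separable closed span of the sequence. -/
theorem exists_weaklyConverges_subseq {H : Type*} [NormedAddCommGroup H] [InnerProductSpace ℝ H]
    [CompleteSpace H] (x : ℕ → H) {C : ℝ} (hx : ∀ n, ‖x n‖ ≤ C) :
    ∃ x₀ : H, ∃ φ : ℕ → ℕ, StrictMono φ ∧ WeaklyConverges (fun n => x (φ n)) x₀ := by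
  let K : Submodule ℝ H := (Submodule.span ℝ (range x)).topologicalClosure
  have hK : TopologicalSpace.IsSeparable (K : Set H) :=
    ((countable_range x).isSeparable.span (R := ℝ)).closure
  have : TopologicalSpace.SeparableSpace K := hK.separableSpace
  have : CompleteSpace K := (Submodule.isClosed_topologicalClosure _).completeSpace_coe
  let y : ℕ → K := fun n => ⟨x n, Submodule.le_topologicalClosure _
    (Submodule.subset_span (mem_range_self n))⟩
  obtain ⟨f, -, φ, hφ, hlim⟩ := WeakDual.isSeqCompact_closedBall ℝ K 0 C
    (x := fun n => StrongDual.toWeakDual (InnerProductSpace.toDual ℝ K (y n))) (fun n => by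
      change InnerProductSpace.toDual ℝ K (y n) ∈ Metric.closedBall 0 C
      rw [mem_closedBall_zero_iff, LinearIsometryEquiv.norm_map]
      exact hx n)
  let x₀ : K := (InnerProductSpace.toDual ℝ K).symm (WeakDual.toStrongDual f)
  refine ⟨x₀, φ, hφ, fun g => ?_⟩
  let z : K := (InnerProductSpace.toDual ℝ K).symm (g ∘L K.subtypeL)
  have hz : ∀ w : K, g w = inner ℝ w z := fun w => by
    rw [real_inner_comm, InnerProductSpace.toDual_symm_apply]
    rfl
  have h1 : Tendsto (fun n => (StrongDual.toWeakDual (InnerProductSpace.toDual ℝ K (y (φ n)))) z)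
      atTop (𝓝 (f z)) := ((WeakDual.eval_continuous z).tendsto f).comp hlim
  have h2 : f z = g x₀ := by
    rw [hz x₀, InnerProductSpace.toDual_symm_apply]
    rfl
  rw [← h2]
  refine h1.congr fun n => ?_
  exact (hz (y (φ n))).symm

/-- A compact operator turns bounded weakly convergent images into strongly convergent ones. -/
theorem IsCompactOperator.tendsto_of_weaklyConverges {κ : E →L[ℝ] F} (hκ : IsCompactOperator κ)
    {x : ℕ → E} {C : ℝ} (hx : ∀ n, ‖x n‖ ≤ C) {y : F} (h : WeaklyConverges (fun n => κ (x n)) y) :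
    Tendsto (fun n => κ (x n)) atTop (𝓝 y) := by
  obtain ⟨K, hK, hsub⟩ := hκ.image_closedBall_subset_compact (𝕜₁ := ℝ) (f := (κ : E →ₗ[ℝ] F)) C
  refine tendsto_of_subseq_tendsto fun ns hns => ?_
  obtain ⟨a, -, φ, hφ, hlim⟩ := hK.tendsto_subseq (x := fun n => κ (x (ns n)))
    fun n => hsub ⟨x (ns n), mem_closedBall_zero_iff.2 (hx _), rfl⟩
  refine ⟨φ, ?_⟩
  have : a = y := by
    refine (SeparatingDual.eq_iff_forall_dual_eq (R := ℝ)).2 fun g => ?_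
    exact tendsto_nhds_unique ((g.continuous.tendsto a).comp hlim)
      ((h g).comp (hns.comp hφ.tendsto_atTop))
  rw [← this]
  exact hlim

end WeakConvergence

/-! ### Reflexive spaces and closedness of images -/

section Reflexive

variable {Y Z : Type*} [NormedAddCommGroup Y] [NormedSpace ℝ Y]
  [NormedAddCommGroup Z] [NormedSpace ℝ Z]

/-- In a reflexive space, a limit of images under `κ` of vectors which frequently have norm at most
`r` is itself the image of a vector of norm at most `r`: take a weak limit along an ultrafilter. -/
theorem IsReflexive.exists_preimage (hZ : IsReflexive Z) (κ : Z →L[ℝ] Y) {Z₀ : Submodule ℝ Z}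
    (hZ₀ : IsClosed (Z₀ : Set Z)) {z : ℕ → Z} (hz : ∀ k, z k ∈ Z₀) {r : ℝ}
    (hr : ∃ᶠ k in atTop, ‖z k‖ ≤ r) {w : Y} (hw : Tendsto (fun k => κ (z k)) atTop (𝓝 w)) :
    ∃ x ∈ Z₀, ‖x‖ ≤ r ∧ κ x = w := by
  have : NeBot (atTop ⊓ 𝓟 {k : ℕ | ‖z k‖ ≤ r}) := frequently_mem_iff_neBot.1 hr
  let U : Ultrafilter ℕ := Ultrafilter.of (atTop ⊓ 𝓟 {k : ℕ | ‖z k‖ ≤ r})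
  have hU : (U : Filter ℕ) ≤ atTop ⊓ 𝓟 {k : ℕ | ‖z k‖ ≤ r} := Ultrafilter.of_le _
  let J := NormedSpace.inclusionInDoubleDual ℝ Z
  have hJ : ∀ x, ‖J x‖ = ‖x‖ := (NormedSpace.inclusionInDoubleDualLi ℝ).norm_map
  let Ψ : ℕ → WeakDual ℝ (StrongDual ℝ Z) := fun k => StrongDual.toWeakDual (J (z k))
  have hball : (U.map Ψ : Filter _) ≤
      𝓟 (WeakDual.toStrongDual ⁻¹' Metric.closedBall (0 : StrongDual ℝ (StrongDual ℝ Z)) r) := by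
    rw [le_principal_iff]
    change ∀ᶠ k in (U : Filter ℕ), _
    filter_upwards [hU (mem_inf_of_right (mem_principal_self _))] with k hk
    change J (z k) ∈ Metric.closedBall 0 r
    exact (mem_closedBall_zero_iff (E := StrongDual ℝ (StrongDual ℝ Z))).2 ((hJ _).trans_le hk)
  obtain ⟨Φ, hΦr, hΦ⟩ := (WeakDual.isCompact_closedBall
    (0 : StrongDual ℝ (StrongDual ℝ Z)) r).ultrafilter_le_nhds _ hball
  obtain ⟨x, hx⟩ := hZ (WeakDual.toStrongDual Φ)
  have hlim : ∀ f : StrongDual ℝ Z, Tendsto (fun k => f (z k)) U (𝓝 (f x)) := by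
    intro f
    have h1 : Tendsto Ψ U (𝓝 Φ) := hΦ
    have h2 : Tendsto (fun k => Ψ k f) U (𝓝 (Φ f)) :=
      ((WeakDual.eval_continuous f).tendsto Φ).comp h1
    have h3 : Φ f = f x := by
      change WeakDual.toStrongDual Φ f = f x
      rw [← hx]
      rfl
    rw [← h3]
    exact h2
  refine ⟨x, ?_, ?_, ?_⟩
  · by_contra hn
    obtain ⟨f, u, h1, h2⟩ := geometric_hahn_banach_closed_point Z₀.convex hZ₀ hn
    exact not_le.2 h2 (le_of_tendsto (hlim f) (Eventually.of_forall fun k => (h1 _ (hz k)).le))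
  · rw [← hJ x]
    have : WeakDual.toStrongDual Φ ∈ Metric.closedBall 0 r := hΦr
    rw [← hx] at this
    exact mem_closedBall_zero_iff.1 this
  · refine (SeparatingDual.eq_iff_forall_dual_eq (R := ℝ)).2 fun g => ?_
    exact tendsto_nhds_unique (hlim (g ∘L κ))
      ((g.continuous.tendsto w).comp (hw.mono_left (hU.trans inf_le_left)))

/-- For an injective operator the preimage of the limit is unique, so its norm is bounded by the lower
limit of the norms. The squares match the integrands of `L²` norms. -/
theorem IsReflexive.exists_preimage_liminf (hZ : IsReflexive Z) (κ : Z →L[ℝ] Y)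
    (hκ : Function.Injective κ) {Z₀ : Submodule ℝ Z}
    (hZ₀ : IsClosed (Z₀ : Set Z)) {z : ℕ → Z} (hz : ∀ k, z k ∈ Z₀)
    (hr : liminf (fun k => ‖z k‖ₑ ^ 2) atTop < ⊤) {w : Y}
    (hw : Tendsto (fun k => κ (z k)) atTop (𝓝 w)) :
    ∃ x ∈ Z₀, ‖x‖ₑ ^ 2 ≤ liminf (fun k => ‖z k‖ₑ ^ 2) atTop ∧ κ x = w := by
  have key : ∀ c : ℝ≥0∞, c < ⊤ → liminf (fun k => ‖z k‖ₑ ^ 2) atTop < c →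
      ∃ x ∈ Z₀, ‖x‖ₑ ^ 2 ≤ c ∧ κ x = w := by
    intro c hc hlt
    have hf : ∃ᶠ k in atTop, ‖z k‖ₑ ^ 2 < c := frequently_lt_of_liminf_lt (by isBoundedDefault) hlt
    obtain ⟨x, hx, hxr, hxw⟩ := hZ.exists_preimage κ hZ₀ hz (r := Real.sqrt c.toReal)
      (hf.mono fun k hk => Real.le_sqrt_of_sq_le (by
        have := ENNReal.toReal_mono hc.ne hk.le
        simpa using this)) hw
    refine ⟨x, hx, ?_, hxw⟩
    rw [← ofReal_norm, ← ENNReal.ofReal_pow (norm_nonneg _)]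
    refine ENNReal.ofReal_le_of_le_toReal ?_
    calc ‖x‖ ^ 2 ≤ Real.sqrt c.toReal ^ 2 := by gcongr
      _ = c.toReal := Real.sq_sqrt ENNReal.toReal_nonneg
  obtain ⟨c, hc1, hc2⟩ := exists_between hr
  obtain ⟨x, hx, -, hxw⟩ := key c hc2 hc1
  refine ⟨x, hx, ?_, hxw⟩
  refine le_of_forall_gt_imp_ge_of_dense fun d hd => ?_
  rcases eq_or_ne d ⊤ with rfl | hd'
  · exact le_top
  · obtain ⟨x', -, h1, h2⟩ := key d hd'.lt_top hd
    rwa [hκ (hxw.trans h2.symm)]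

end Reflexive

section ClosedImage

variable {Y Z : Type*} [NormedAddCommGroup Y] [NormedSpace ℝ Y] [CompleteSpace Y]
  [NormedAddCommGroup Z] [NormedSpace ℝ Z] [CompleteSpace Z] {T : ℝ}

theorem liminf_add_liminf_le (a b : ℕ → ℝ≥0∞) :
    liminf a atTop + liminf b atTop ≤ liminf (fun n => a n + b n) atTop := by
  simp only [liminf_eq_iSup_iInf_of_nat]
  rw [ENNReal.iSup_add_iSup_of_monotone]
  · exact iSup_mono fun n => le_iInf₂ fun i hi => add_le_add (iInf₂_le i hi) (iInf₂_le i hi)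
  · exact fun m n hmn => le_iInf₂ fun i hi => iInf₂_le i (hmn.trans hi)
  · exact fun m n hmn => le_iInf₂ fun i hi => iInf₂_le i (hmn.trans hi)

theorem lintegral_enorm_sq {G : Type*} [NormedAddCommGroup G] (g : Lp G 2 (timeMeasure T)) :
    ∫⁻ t, ‖g t‖ₑ ^ 2 ∂(timeMeasure T) = ENNReal.ofReal (‖g‖ ^ 2) := by
  have h := eLpNorm_nnreal_pow_eq_lintegral (f := g) (μ := timeMeasure T) (p := 2) (by norm_num)
  simp only [NNReal.coe_ofNat, ENNReal.rpow_ofNat] at h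
  rw [← h, Lp.norm_def, ENNReal.ofReal_pow ENNReal.toReal_nonneg,
    ENNReal.ofReal_toReal (Lp.eLpNorm_ne_top g)]
  rfl

theorem lintegral_enorm_sq_ofRate (g : Lp Z 2 (timeMeasure T)) :
    ∫⁻ t, (‖primitive T g t‖ₑ ^ 2 + ‖g t‖ₑ ^ 2) ∂(timeMeasure T)
      = ENNReal.ofReal (‖ofRate Z T g‖ ^ 2) := by
  rw [norm_ofRate_sq, ENNReal.ofReal_add (by positivity) (by positivity), ← lintegral_enorm_sq,
    ← lintegral_enorm_sq, lintegral_add_left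
    ((continuous_primitive (integrable_coeFn g)).enorm.measurable.pow_const 2)]
  congr 1
  refine lintegral_congr_ae ?_
  filter_upwards [coeFn_volterra g] with t ht
  rw [ht]

theorem exists_isClosed_separable_submodule {Z : Type*} [NormedAddCommGroup Z]
    [NormedSpace ℝ Z] (g : ℕ → Lp Z 2 (timeMeasure T)) :
    ∃ Z₀ : Submodule ℝ Z, IsClosed (Z₀ : Set Z) ∧ TopologicalSpace.SeparableSpace Z₀ ∧
      ∀ m t, g m t ∈ Z₀ := by
  let Z₀ : Submodule ℝ Z := (Submodule.span ℝ (⋃ m, range (g m))).topologicalClosure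
  have hs : TopologicalSpace.IsSeparable (⋃ m, range (g m : ℝ → Z)) :=
    TopologicalSpace.IsSeparable.iUnion fun m =>
      (Lp.stronglyMeasurable (g m)).isSeparable_range
  have hK : TopologicalSpace.IsSeparable (Z₀ : Set Z) := (hs.span (R := ℝ)).closure
  exact ⟨Z₀, Submodule.isClosed_topologicalClosure _, hK.separableSpace, fun m t =>
    Submodule.le_topologicalClosure _ (Submodule.subset_span (mem_iUnion.2 ⟨m, t, rfl⟩))⟩

/-- Measurable inversion of an injective operator on a separable closed subspace, by the
Lusin–Souslin theorem. -/
theorem exists_aestronglyMeasurable_preimage {Y : Type*} [NormedAddCommGroup Y]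
    [NormedSpace ℝ Y] (κ : Z →L[ℝ] Y) (hκ : Function.Injective κ)
    {Z₀ : Submodule ℝ Z} (hZ₀ : IsClosed (Z₀ : Set Z)) [TopologicalSpace.SeparableSpace Z₀]
    {μ : Measure ℝ} {G : ℝ → Y} (hG : AEStronglyMeasurable G μ)
    (h : ∀ᵐ t ∂μ, ∃ x ∈ Z₀, κ x = G t) :
    ∃ f : ℝ → Z, AEStronglyMeasurable f μ ∧ ∀ᵐ t ∂μ, κ (f t) = G t := by
  borelize Y
  let _ : MeasurableSpace Z₀ := borel Z₀
  have : BorelSpace Z₀ := ⟨rfl⟩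
  have : CompleteSpace Z₀ := hZ₀.completeSpace_coe
  have : SecondCountableTopology Z₀ := UniformSpace.secondCountable_of_separable Z₀
  have hemb : MeasurableEmbedding (fun x : Z₀ => κ x) :=
    (κ.continuous.comp continuous_subtype_val).measurableEmbedding
      (hκ.comp Subtype.val_injective)
  obtain ⟨G', hG', hGG'⟩ := hG
  have hm : Measurable fun t => hemb.invFun (G' t) :=
    hemb.measurable_invFun.comp hG'.measurable
  refine ⟨fun t => (hemb.invFun (G' t) : Z),
    (continuous_subtype_val.comp_stronglyMeasurable hm.stronglyMeasurable).aestronglyMeasurable, ?_⟩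
  filter_upwards [h, hGG'] with t ⟨x, hx, hxt⟩ ht
  have e : G' t = (fun x : Z₀ => κ x) ⟨x, hx⟩ := by rw [← ht, ← hxt]
  rw [e, hemb.leftInverse_invFun, hxt]

/-- The image under `κ` of the rates of a closed ball of `H¹₀(0, T; Z)` is closed in `L²(0, T; Y)`.
This replaces the weak compactness of balls of `L²(0, T; Z)`: a strong limit of images is attained
pointwise by reflexivity of `Z`, and Fatou's lemma controls the norm. -/
theorem IsReflexive.exists_rate_of_tendsto (hZ : IsReflexive Z) (κ : Z →L[ℝ] Y)
    (hκ : Function.Injective κ) {g : ℕ → Lp Z 2 (timeMeasure T)} {G : Lp Y 2 (timeMeasure T)}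
    {r : ℝ} (hr : ∀ m, ‖ofRate Z T (g m)‖ ≤ r)
    (h : Tendsto (fun m => κ.compLp (g m)) atTop (𝓝 G)) :
    ∃ f : Lp Z 2 (timeMeasure T), κ.compLp f = G ∧ ‖ofRate Z T f‖ ≤ r := by
  obtain ⟨ns, hns, hae⟩ := (tendstoInMeasure_of_tendsto_Lp h).exists_seq_tendsto_ae
  have hr0 : 0 ≤ r := (norm_nonneg _).trans (hr 0)
  obtain ⟨Z₀, hZ₀, hsep, hmem⟩ := exists_isClosed_separable_submodule fun m => g (ns m)
  have hcomp : ∀ᵐ t ∂(timeMeasure T), ∀ m, κ.compLp (g (ns m)) t = κ (g (ns m) t) :=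
    ae_all_iff.2 fun m => κ.coeFn_compLp _
  have hmeas : ∀ m, Measurable fun t => ‖g (ns m) t‖ₑ ^ 2 := fun m =>
    (Lp.stronglyMeasurable (g (ns m))).enorm.pow_const 2
  have hmeas' : ∀ m, Measurable fun t => ‖primitive T (g (ns m)) t‖ₑ ^ 2 := fun m =>
    (continuous_primitive (integrable_coeFn _)).enorm.measurable.pow_const 2
  have hfat : ∫⁻ t, liminf (fun m => ‖primitive T (g (ns m)) t‖ₑ ^ 2 + ‖g (ns m) t‖ₑ ^ 2) atTop
      ∂(timeMeasure T) ≤ ENNReal.ofReal (r ^ 2) := by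
    refine (lintegral_liminf_le fun m => (hmeas' m).add (hmeas m)).trans ?_
    refine (liminf_le_limsup (by isBoundedDefault) (by isBoundedDefault)).trans
      (limsup_le_of_le (by isBoundedDefault) (Eventually.of_forall fun m => ?_))
    refine (lintegral_enorm_sq_ofRate (g (ns m))).trans_le ?_
    have := hr (ns m)
    gcongr
  have hsum : ∀ t, liminf (fun m => ‖primitive T (g (ns m)) t‖ₑ ^ 2) atTop
      + liminf (fun m => ‖g (ns m) t‖ₑ ^ 2) atTop
      ≤ liminf (fun m => ‖primitive T (g (ns m)) t‖ₑ ^ 2 + ‖g (ns m) t‖ₑ ^ 2) atTop :=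
    fun t => liminf_add_liminf_le _ _
  have hfin : ∀ᵐ t ∂(timeMeasure T), liminf (fun m => ‖g (ns m) t‖ₑ ^ 2) atTop < ⊤ := by
    refine ae_lt_top (Measurable.liminf hmeas) (ne_top_of_le_ne_top
      (ENNReal.ofReal_ne_top (r := r ^ 2)) ?_)
    exact (lintegral_mono fun t => le_add_self.trans (hsum t)).trans hfat
  have hpt : ∀ᵐ t ∂(timeMeasure T), ∃ x ∈ Z₀, ‖x‖ₑ ^ 2
      ≤ liminf (fun m => ‖g (ns m) t‖ₑ ^ 2) atTop ∧ κ x = G t := by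
    filter_upwards [hae, hcomp, hfin] with t h1 h2 h3
    exact hZ.exists_preimage_liminf κ hκ hZ₀ (fun m => hmem m t) h3 (by simpa only [h2] using h1)
  obtain ⟨f, hf, hfG⟩ := exists_aestronglyMeasurable_preimage κ hκ hZ₀
    (Lp.aestronglyMeasurable G) (hpt.mono fun t ⟨x, h1, _, h2⟩ => ⟨x, h1, h2⟩)
  have hfle : ∀ᵐ t ∂(timeMeasure T), ‖f t‖ₑ ^ 2 ≤ liminf (fun m => ‖g (ns m) t‖ₑ ^ 2) atTop := by
    filter_upwards [hpt, hfG] with t ⟨x, _, h1, h2⟩ h3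
    rwa [hκ (h3.trans h2.symm)]
  have hfL : MemLp f 2 (timeMeasure T) := by
    refine ⟨hf, (eLpNorm_lt_top_iff_lintegral_rpow_enorm_lt_top (by norm_num) (by norm_num)).2 ?_⟩
    simp only [ENNReal.toReal_ofNat, ENNReal.rpow_ofNat]
    exact lt_of_le_of_lt ((lintegral_mono_ae (hfle.mono fun t ht =>
      ht.trans (le_add_self.trans (hsum t)))).trans hfat) ENNReal.ofReal_lt_top
  let f' : Lp Z 2 (timeMeasure T) := hfL.toLp f
  have hf' : f' =ᵐ[timeMeasure T] f := hfL.coeFn_toLp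
  have hG' : κ.compLp f' = G := by
    refine Lp.ext ?_
    filter_upwards [κ.coeFn_compLp f', hf', hfG] with t h1 h2 h3
    rw [h1, h2, h3]
  have hprim : ∀ (e : Lp Z 2 (timeMeasure T)) t,
      κ (primitive T e t) = primitiveAt Y T t (κ.compLp e) := fun e t => by
    rw [primitiveAt_apply, primitive_congr (κ.coeFn_compLp e), primitive_clm κ (integrable_coeFn e)]
  have hple : ∀ t, ‖primitive T f' t‖ₑ ^ 2
      ≤ liminf (fun m => ‖primitive T (g (ns m)) t‖ₑ ^ 2) atTop := by
    intro t
    rcases eq_or_ne (liminf (fun m => ‖primitive T (g (ns m)) t‖ₑ ^ 2) atTop) ⊤ with htop | htop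
    · rw [htop]
      exact le_top
    have hlim : Tendsto (fun m => κ (primitive T (g (ns m)) t)) atTop
        (𝓝 (κ (primitive T f' t))) := by
      simp only [hprim, hG']
      exact (((primitiveAt Y T t).continuous.tendsto G).comp h).comp hns.tendsto_atTop
    obtain ⟨x, -, hx, hxw⟩ := hZ.exists_preimage_liminf κ hκ (Z₀ := ⊤) isClosed_univ
      (fun _ => trivial) htop.lt_top hlim
    rwa [← hκ hxw]
  refine ⟨f', hG', le_of_sq_le_sq ?_ hr0⟩
  rw [← ENNReal.ofReal_le_ofReal_iff (by positivity), ← lintegral_enorm_sq_ofRate]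
  refine (lintegral_mono_ae ?_).trans hfat
  filter_upwards [hf', hfle] with t h1 h2
  rw [h1]
  exact (add_le_add (hple t) h2).trans (hsum t)

/-- Weak closedness of the image under `κ` of the rates of a closed ball of `H¹₀(0, T; Z)`. -/
theorem IsReflexive.exists_rate_of_weaklyConverges (hZ : IsReflexive Z) (κ : Z →L[ℝ] Y)
    (hκ : Function.Injective κ) {g : ℕ → Lp Z 2 (timeMeasure T)} {G : Lp Y 2 (timeMeasure T)}
    {r : ℝ} (hr : ∀ᶠ m in atTop, ‖ofRate Z T (g m)‖ ≤ r)
    (h : WeaklyConverges (fun m => κ.compLp (g m)) G) :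
    ∃ f : Lp Z 2 (timeMeasure T), κ.compLp f = G ∧ ‖ofRate Z T f‖ ≤ r := by
  let C : Set (Lp Y 2 (timeMeasure T)) :=
    κ.compLpL 2 (timeMeasure T) '' ((ofRate Z T) ⁻¹' Metric.closedBall 0 r)
  have hC : Convex ℝ C :=
    ((convex_closedBall 0 r).linear_preimage (ofRate Z T).toLinearMap).linear_image
      (κ.compLpL 2 (timeMeasure T)).toLinearMap
  have hcl : IsClosed C := by
    refine IsSeqClosed.isClosed fun x a hx hlim => ?_
    choose g hg hgx using hx
    obtain ⟨f, hf, hfr⟩ := hZ.exists_rate_of_tendsto κ hκ (g := g) (G := a) (r := r)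
      (fun m => mem_closedBall_zero_iff.1 (hg m)) (by
        refine hlim.congr fun m => ?_
        exact (hgx m).symm)
    exact ⟨f, mem_closedBall_zero_iff.2 hfr, hf⟩
  obtain ⟨f, hf, hfG⟩ := h.mem_of_convex hC hcl
    (hr.mono fun m hm => ⟨g m, mem_closedBall_zero_iff.2 hm, rfl⟩)
  exact ⟨f, hfG, mem_closedBall_zero_iff.1 hf⟩

end ClosedImage

/-! ### The dissipation functional and its subdifferential -/

section Dissipation

variable {X Y : Type*} [NormedAddCommGroup X]
  [NormedAddCommGroup Y] [InnerProductSpace ℝ Y] {R : X → Y → ℝ≥0∞}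

theorem coe_ennreal_eq_coe_toReal {a : ℝ≥0∞} (ha : a ≠ ⊤) : (a : EReal) = (a.toReal : EReal) := by
  lift a to ℝ≥0 using ha
  rfl

theorem IsDissipation.apply_zero (hR : IsDissipation R) (ζ : X) : R ζ 0 = 0 := by
  simpa using hR.homogeneous ζ 0 0

theorem IsDissipation.mem_dom_iff (hR : IsDissipation R) (ζ : X) (η : Y) :
    η ∈ dom R ↔ R ζ η < ⊤ := by
  rw [dom, hR.dom_indep 0 ζ]
  rfl

/-- The mixed Lipschitz condition, tested with `η₁ = 0`, makes `R(·, η)` Lipschitz continuous with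
constant proportional to `‖η‖`. -/
theorem IsDissipation.exists_le_add (hR : IsDissipation R) : ∃ L : ℝ, 0 ≤ L ∧ ∀ ζ₁ ζ₂ η,
    R ζ₁ η ≤ R ζ₂ η + ENNReal.ofReal (L * ‖ζ₁ - ζ₂‖ * ‖η‖) := by
  obtain ⟨L, hL, h⟩ := hR.lipschitz
  refine ⟨L, hL, fun ζ₁ ζ₂ η => ?_⟩
  have h0 : (0 : Y) ∈ dom R := by
    rw [hR.mem_dom_iff 0, hR.apply_zero]
    exact ENNReal.zero_lt_top
  by_cases hη : η ∈ dom R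
  · have h1 := ((hR.mem_dom_iff ζ₁ η).1 hη).ne
    have h2 := ((hR.mem_dom_iff ζ₂ η).1 hη).ne
    have h3 := h ζ₁ ζ₂ 0 h0 η hη
    simp only [hR.apply_zero, ENNReal.toReal_zero, zero_sub, norm_neg] at h3
    rw [← ENNReal.ofReal_toReal h1, ← ENNReal.ofReal_toReal h2,
      ← ENNReal.ofReal_add ENNReal.toReal_nonneg (by positivity)]
    exact ENNReal.ofReal_le_ofReal (by linarith)
  · have h2 : R ζ₂ η = ⊤ := not_lt_top_iff.1 fun h' => hη ((hR.mem_dom_iff ζ₂ η).2 h')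
    rw [h2, top_add]
    exact le_top

theorem IsDissipation.lowerSemicontinuous_uncurry (hR : IsDissipation R) :
    LowerSemicontinuous (fun p : X × Y => R p.1 p.2) := by
  obtain ⟨L, hL, hle⟩ := hR.exists_le_add
  rintro ⟨ζ, η⟩ y hy
  obtain ⟨c, hyc, hc⟩ := exists_between hy
  have h1 : ∀ᶠ p : X × Y in 𝓝 (ζ, η), c < R ζ p.2 :=
    (continuous_snd.tendsto (ζ, η)).eventually (hR.lsc ζ η c hc)
  have hcont : Continuous fun p : X × Y => ENNReal.ofReal (L * ‖ζ - p.1‖ * ‖p.2‖) :=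
    ENNReal.continuous_ofReal.comp (by fun_prop)
  have h2 : ∀ᶠ p : X × Y in 𝓝 (ζ, η), ENNReal.ofReal (L * ‖ζ - p.1‖ * ‖p.2‖) < c - y := by
    refine (hcont.tendsto (ζ, η)).eventually_lt_const ?_
    simpa using hyc
  filter_upwards [h1, h2] with p hp1 hp2
  by_contra! hp
  have h3 : c < y + (c - y) :=
    (hp1.trans_le (hle ζ p.1 p.2)).trans_le (add_le_add hp hp2.le)
  rw [add_tsub_cancel_of_le hyc.le] at h3
  exact lt_irrefl _ h3

theorem IsDissipation.aemeasurable_comp (hR : IsDissipation R) {μ : Measure ℝ} {ζ : ℝ → X}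
    {η : ℝ → Y} (hζ : AEStronglyMeasurable ζ μ) (hη : AEStronglyMeasurable η μ) :
    AEMeasurable (fun t => R (ζ t) (η t)) μ := by
  borelize (X × Y)
  exact hR.lowerSemicontinuous_uncurry.measurable.comp_aemeasurable (hζ.prodMk hη).aemeasurable

/-- For a positively homogeneous functional, a subgradient is characterised by the stability
condition `⟨φ, ·⟩ ≤ R(ζ, ·)` together with the energy balance at the point. -/
theorem IsDissipation.mem_subdifferential_iff (hR : IsDissipation R) (ζ : X) (y : Y)
    (φ : StrongDual ℝ Y) : φ ∈ subdifferential (fun η => (R ζ η : EReal)) y ↔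
      (∀ v, ENNReal.ofReal (φ v) ≤ R ζ v) ∧ R ζ y < ⊤ ∧ (R ζ y).toReal ≤ φ y := by
  constructor
  · intro h
    have h0 := h 0
    simp only [hR.apply_zero, zero_sub, map_neg] at h0
    have hfin : R ζ y ≠ ⊤ := by
      intro htop
      rw [htop, EReal.coe_ennreal_top, EReal.top_add_coe] at h0
      simp at h0
    have hcoe : ((R ζ y : ℝ≥0∞) : EReal) = ((R ζ y).toReal : EReal) :=
      coe_ennreal_eq_coe_toReal hfin
    refine ⟨fun v => ?_, hfin.lt_top, ?_⟩
    · by_cases hv : R ζ v = ⊤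
      · rw [hv]
        exact le_top
      -- Large multiples of `v` contradict the subgradient inequality if `R ζ v < φ v`.
      by_contra! hlt
      have hc : (R ζ v).toReal < φ v := by
        rw [← ENNReal.ofReal_toReal hv] at hlt
        exact (ENNReal.ofReal_lt_ofReal_iff'.1 hlt).1
      have hn : ∀ n : ℝ≥0, (R ζ y).toReal + (n * φ v - φ y) ≤ n * (R ζ v).toReal := by
        intro n
        have := h (n • v)
        simp only [hcoe, hR.homogeneous] at this
        have h2 : (((n : ℝ≥0∞) * R ζ v : ℝ≥0∞) : EReal)
            = ((n * (R ζ v).toReal : ℝ) : EReal) := by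
          rw [coe_ennreal_eq_coe_toReal (ENNReal.mul_ne_top ENNReal.coe_ne_top hv)]
          simp
        rw [h2, ← EReal.coe_add, EReal.coe_le_coe_iff, map_sub] at this
        simpa [NNReal.smul_def] using this
      obtain ⟨n, hn'⟩ := exists_nat_gt (φ y / (φ v - (R ζ v).toReal))
      rw [div_lt_iff₀ (by linarith)] at hn'
      have := hn n
      have h3 : 0 ≤ (R ζ y).toReal := ENNReal.toReal_nonneg
      push_cast at this
      nlinarith
    · rw [hcoe, ← EReal.coe_add, EReal.coe_ennreal_zero, ← EReal.coe_zero,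
        EReal.coe_le_coe_iff] at h0
      linarith
  · rintro ⟨h1, h2, h3⟩ v
    by_cases hv : R ζ v = ⊤
    · simp [hv]
    simp only [coe_ennreal_eq_coe_toReal h2.ne, coe_ennreal_eq_coe_toReal hv]
    rw [← EReal.coe_add, EReal.coe_le_coe_iff, map_sub]
    have := (ENNReal.ofReal_le_iff_le_toReal hv).1 (h1 v)
    linarith

end Dissipation

/-! ### The history operator -/

section History

variable {X Y : Type*} [NormedAddCommGroup X] [NormedSpace ℝ X]
  [NormedAddCommGroup Y] [InnerProductSpace ℝ Y] {T : ℝ}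

/-- The history operator applied to the primitive of `g`, written as a convolution over the fixed
interval `(0, T)`; the primitive vanishes at negative times. -/
noncomputable def rateHistory (T : ℝ) (B : ℝ → Y →L[ℝ] X) (y₀ : X) (g : ℝ → Y) (t : ℝ) : X :=
  (∫ r, B r (primitive T g (t - r)) ∂(timeMeasure T)) + y₀

theorem integrable_rateHistory {B : ℝ → Y →L[ℝ] X} (hB : Integrable B (timeMeasure T))
    {g : ℝ → Y} (hg : Integrable g (timeMeasure T)) (t : ℝ) :
    Integrable (fun r => B r (primitive T g (t - r))) (timeMeasure T) := by
  refine Integrable.mono' (hB.norm.mul_const (∫ s, ‖g s‖ ∂(timeMeasure T))) ?_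
    (ae_of_all _ fun r => ?_)
  · exact isBoundedBilinearMap_apply.continuous.comp_aestronglyMeasurable
      (hB.aestronglyMeasurable.prodMk
        ((continuous_primitive hg).comp (continuous_const.sub continuous_id)).aestronglyMeasurable)
  · exact ((B r).le_opNorm _).trans (by gcongr; exact norm_primitive_le hg _)

theorem history_eq_rateHistory {B : ℝ → Y →L[ℝ] X} (y₀ : X) {y g : ℝ → Y}
    (hy : y =ᵐ[timeMeasure T] primitive T g) {t : ℝ} (ht : t ∈ Ioo 0 T) :
    history B y₀ y t = rateHistory T B y₀ g t := by
  unfold history rateHistory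
  congr 1
  calc ∫ s in (0 : ℝ)..t, B (t - s) (y s)
      = ∫ s in (0 : ℝ)..t, (fun r => B r (primitive T g (t - r))) (t - s) := by
        refine intervalIntegral.integral_congr_ae' ?_ ?_
        · have h1 := (ae_restrict_iff' measurableSet_Ioo).1 hy
          filter_upwards [h1] with s hs hst
          simp [hs ⟨hst.1, hst.2.trans_lt ht.2⟩]
        · exact ae_of_all _ fun s hs => absurd (hs.1.trans_le hs.2) (not_lt.2 ht.1.le)
    _ = ∫ r in Ioo 0 t, B r (primitive T g (t - r)) := by
        rw [intervalIntegral.integral_comp_sub_left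
            (fun r => B r (primitive T g (t - r))), sub_self, sub_zero,
          intervalIntegral.integral_of_le ht.1.le, integral_Ioc_eq_integral_Ioo]
    _ = ∫ r in Ioo 0 T, B r (primitive T g (t - r)) := by
        refine (setIntegral_eq_of_subset_of_forall_sdiff_eq_zero measurableSet_Ioo
          (Ioo_subset_Ioo_right ht.2.le) fun r hr => ?_).symm
        have : t ≤ r := not_lt.1 fun h => hr.2 ⟨hr.1.1, h⟩
        rw [primitive_of_nonpos _ (sub_nonpos.2 this), map_zero]

/-- The history operator is Lipschitz in time with a constant controlled by the variation
`∫₀ᵗ ‖g‖` accumulated so far. -/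
theorem norm_rateHistory_sub_le {B : ℝ → Y →L[ℝ] X} (hB : Integrable B (timeMeasure T)) {C : ℝ}
    (hC : 0 ≤ C) (hBC : ∀ᵐ t ∂(timeMeasure T), ‖B t‖ ≤ C) (hT : 0 < T) (y₀ : X) {g : ℝ → Y}
    (hg : Integrable g (timeMeasure T)) {s t : ℝ} (hst : s ≤ t) :
    ‖rateHistory T B y₀ g t - rateHistory T B y₀ g s‖
      ≤ C * ((t - s) * primitive T (fun r => ‖g r‖) t) := by
  set V := primitive T (fun r => ‖g r‖) with hV
  have hVc : Continuous V := continuous_primitive hg.norm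
  have hVi : ∀ a b, IntervalIntegrable V volume a b := hVc.intervalIntegrable
  have e1 : rateHistory T B y₀ g t - rateHistory T B y₀ g s
      = ∫ r, B r (primitive T g (t - r) - primitive T g (s - r)) ∂(timeMeasure T) := by
    unfold rateHistory
    rw [add_sub_add_right_eq_sub,
      ← integral_sub (integrable_rateHistory hB hg t) (integrable_rateHistory hB hg s)]
    simp only [map_sub]
  have e2 : ∀ a : ℝ, ∫ r, V (a - r) ∂(timeMeasure T) = ∫ r in (a - T)..a, V r := fun a => by
    rw [timeMeasure, ← integral_Ioc_eq_integral_Ioo, ← intervalIntegral.integral_of_le hT.le,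
      intervalIntegral.integral_comp_sub_left, sub_zero]
  have hint : ∀ a : ℝ, Integrable (fun r => V (a - r)) (timeMeasure T) := fun a =>
    (hVc.comp (continuous_const.sub continuous_id)).integrableOn_Icc.mono_set Ioo_subset_Icc_self
  have hle : ∫ r in s..t, V r ≤ (t - s) * V t := by
    calc ∫ r in s..t, V r ≤ ∫ _ in s..t, V t :=
          intervalIntegral.integral_mono_on hst (hVi _ _) intervalIntegrable_const
            fun r hr => primitive_norm_mono hg hr.2
      _ = (t - s) * V t := by simp
  have hnn : 0 ≤ ∫ r in (s - T)..(t - T), V r :=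
    intervalIntegral.integral_nonneg (by linarith) fun r _ => primitive_norm_nonneg hg r
  calc ‖rateHistory T B y₀ g t - rateHistory T B y₀ g s‖
      ≤ ∫ r, C * (V (t - r) - V (s - r)) ∂(timeMeasure T) := by
        rw [e1]
        refine norm_integral_le_of_norm_le (((hint t).sub (hint s)).const_mul C) ?_
        filter_upwards [hBC] with r hr
        refine ((B r).le_opNorm _).trans ?_
        gcongr
        exact norm_primitive_sub_le hg (by linarith)
    _ = C * ((∫ r in (t - T)..t, V r) - ∫ r in (s - T)..s, V r) := by
        rw [integral_const_mul, integral_sub (hint t) (hint s), e2, e2]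
    _ = C * ((∫ r in s..t, V r) - ∫ r in (s - T)..(t - T), V r) := by
        rw [intervalIntegral.integral_interval_sub_interval_comm (hVi _ _) (hVi _ _) (hVi _ _),
          intervalIntegral.integral_symm s t, intervalIntegral.integral_symm (s - T) (t - T)]
        ring
    _ ≤ C * ((t - s) * V t) := by gcongr; linarith

theorem continuous_rateHistory {B : ℝ → Y →L[ℝ] X} (hB : Integrable B (timeMeasure T)) {C : ℝ}
    (hC : 0 ≤ C) (hBC : ∀ᵐ t ∂(timeMeasure T), ‖B t‖ ≤ C) (hT : 0 < T) (y₀ : X) {g : ℝ → Y}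
    (hg : Integrable g (timeMeasure T)) : Continuous (rateHistory T B y₀ g) := by
  set D := ∫ s, ‖g s‖ ∂(timeMeasure T)
  have hD : 0 ≤ D := integral_nonneg fun _ => norm_nonneg _
  have key : ∀ s t, s ≤ t → dist (rateHistory T B y₀ g t) (rateHistory T B y₀ g s)
      ≤ C * D * dist t s := by
    intro s t hst
    rw [dist_eq_norm, Real.dist_eq, abs_of_nonneg (sub_nonneg.2 hst)]
    refine (norm_rateHistory_sub_le hB hC hBC hT y₀ hg hst).trans ?_
    rw [mul_assoc, mul_comm D]
    have := sub_nonneg.2 hst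
    gcongr
    exact primitive_norm_le hg t
  refine (LipschitzWith.of_dist_le_mul (K := ⟨C * D, by positivity⟩) fun t s => ?_).continuous
  rcases le_total s t with h | h
  · exact key s t h
  · rw [dist_comm, dist_comm t]
    exact key t s h

end History

/-! ### Energetic form of the differential inclusion -/

section Energetic

variable {X Y Z : Type*} [NormedAddCommGroup X] [NormedSpace ℝ X]
  [NormedAddCommGroup Y] [InnerProductSpace ℝ Y]
  [NormedAddCommGroup Z] [NormedSpace ℝ Z]
  {T : ℝ} {R : X → Y → ℝ≥0∞} {B : ℝ → Y →L[ℝ] X} {y₀ : X}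

/-- The operator `Z → Y` obtained from `ι : Z → Y*` by identifying `Y*` with `Y`. -/
noncomputable def rieszRep [CompleteSpace Y] (ι : Z →L[ℝ] StrongDual ℝ Y) : Z →L[ℝ] Y :=
  LinearMap.mkContinuous
    { toFun := fun z => (InnerProductSpace.toDual ℝ Y).symm (ι z)
      map_add' := by simp
      map_smul' := by simp } ‖ι‖ (by
      intro z
      simpa using ι.le_opNorm z)

theorem inner_rieszRep [CompleteSpace Y] (ι : Z →L[ℝ] StrongDual ℝ Y) (z : Z) (y : Y) :
    inner ℝ (rieszRep ι z) y = ι z y := InnerProductSpace.toDual_symm_apply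

theorem rieszRep_injective [CompleteSpace Y] {ι : Z →L[ℝ] StrongDual ℝ Y} (hι : Function.Injective ι) :
    Function.Injective (rieszRep ι) :=
  (InnerProductSpace.toDual ℝ Y).symm.injective.comp hι

theorem isCompactOperator_rieszRep [CompleteSpace Y] {ι : Z →L[ℝ] StrongDual ℝ Y} (hι : IsCompactOperator ι) :
    IsCompactOperator (rieszRep ι) :=
  hι.continuous_comp (InnerProductSpace.toDual ℝ Y).symm.continuous

/-- The driving force `-∂_q ℰ(t, q(t)) = κ ℓ(t) - A q(t)`, as an element of `Y`, for a load and a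
state with weak derivatives `h` and `g`. -/
noncomputable def drivingForce (T : ℝ) (κ : Z →L[ℝ] Y) (A : Y →L[ℝ] Y) (h : ℝ → Z) (g : ℝ → Y)
    (t : ℝ) : Y :=
  κ (primitive T h t) - A (primitive T g t)

/-- The energetic formulation of the rate-independent system in terms of the weak derivatives `h`
of the load and `g` of the state: stability at all times, and energy balance almost everywhere. -/
structure IsEnergeticSolution (T : ℝ) (κ : Z →L[ℝ] Y) (A : Y →L[ℝ] Y) (R : X → Y → ℝ≥0∞)
    (B : ℝ → Y →L[ℝ] X) (y₀ : X) (h : ℝ → Z) (g : ℝ → Y) : Prop where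
  stable : ∀ t ∈ Ioo 0 T, ∀ η : Y,
    ENNReal.ofReal (inner ℝ (drivingForce T κ A h g t) η) ≤ R (rateHistory T B y₀ g t) η
  balance : ∀ᵐ t ∂(timeMeasure T), R (rateHistory T B y₀ g t) (g t) < ⊤ ∧
    (R (rateHistory T B y₀ g t) (g t)).toReal ≤ inner ℝ (drivingForce T κ A h g t) (g t)

theorem nonneg_of_ae_nonneg {F : ℝ → ℝ} (hF : Continuous F)
    (h : ∀ᵐ t ∂(timeMeasure T), 0 ≤ F t) {t : ℝ} (ht : t ∈ Ioo 0 T) : 0 ≤ F t := by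
  have h1 : EqOn (fun t => max (F t) 0) F (Ioo 0 T) :=
    Measure.eqOn_open_of_ae_eq (h.mono fun t ht => max_eq_left ht) isOpen_Ioo
      (hF.max continuous_const).continuousOn hF.continuousOn
  rw [← h1 ht]
  exact le_max_right _ _

theorem continuous_drivingForce (κ : Z →L[ℝ] Y) (A : Y →L[ℝ] Y) (h : Lp Z 2 (timeMeasure T))
    (g : Lp Y 2 (timeMeasure T)) : Continuous (drivingForce T κ A h g) :=
  (κ.continuous.comp (continuous_primitive (integrable_coeFn h))).sub
    (A.continuous.comp (continuous_primitive (integrable_coeFn g)))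

/-- Stability at almost every time extends to every time, because the driving force and the history
are continuous in time and `R(·, η)` is Lipschitz. -/
theorem stable_of_ae {X Y : Type*} [NormedAddCommGroup X] [NormedAddCommGroup Y]
    [InnerProductSpace ℝ Y] {R : X → Y → ℝ≥0∞} (hR : IsDissipation R)
    {H : ℝ → X} (hH : Continuous H) {σ : ℝ → Y}
    (hσ : Continuous σ) {η : Y}
    (h : ∀ᵐ t ∂(timeMeasure T), ENNReal.ofReal (inner ℝ (σ t) η) ≤ R (H t) η)
    {t : ℝ} (ht : t ∈ Ioo 0 T) : ENNReal.ofReal (inner ℝ (σ t) η) ≤ R (H t) η := by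
  obtain ⟨L, hL, hle⟩ := hR.exists_le_add
  by_cases htop : R (H t) η = ⊤
  · rw [htop]
    exact le_top
  have hF : Continuous fun s =>
      (R (H t) η).toReal + L * ‖H s - H t‖ * ‖η‖ - inner ℝ (σ s) η := by fun_prop
  have := nonneg_of_ae_nonneg hF (T := T) (by
    filter_upwards [h] with s hs
    have h1 := hs.trans (hle (H s) (H t) η)
    rw [← ENNReal.ofReal_toReal htop, ← ENNReal.ofReal_add ENNReal.toReal_nonneg (by positivity),
      ENNReal.ofReal_le_ofReal_iff (by positivity)] at h1
    linarith) ht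
  refine (ENNReal.ofReal_le_iff_le_toReal htop).2 ?_
  simp only [sub_self, norm_zero, mul_zero, zero_mul, add_zero] at this
  linarith

theorem neg_fderiv_energy [CompleteSpace Y] {A : Y →L[ℝ] Y} (hA : IsSelfAdjoint A) (ℓ : ℝ → StrongDual ℝ Y)
    (t : ℝ) (q v : Y) : (-fderiv ℝ (energy A ℓ t) q) v = ℓ t v - inner ℝ (A q) v := by
  have h1 : HasFDerivAt (fun y => inner ℝ (A y) y)
      ((fderivInnerCLM ℝ (A q, q)).comp (A.prod (ContinuousLinearMap.id ℝ Y))) q :=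
    A.hasFDerivAt.inner ℝ (hasFDerivAt_id q)
  have h2 : HasFDerivAt (energy A ℓ t) _ q :=
    (h1.const_mul (1 / 2 : ℝ)).sub (ℓ t).hasFDerivAt
  rw [h2.fderiv]
  have h3 : inner ℝ (A v) q = inner ℝ (A q) v := by
    rw [real_inner_comm]
    exact ((ContinuousLinearMap.isSelfAdjoint_iff_isSymmetric.1 hA) q v).symm
  simp [h3, fderivInnerCLM_apply]
  ring

/-- The admissible pairs are the energetic solutions. -/
theorem mem_admissiblePairs_iff [CompleteSpace X] [CompleteSpace Y] [CompleteSpace Z]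
    (hT : 0 < T) {A : Y →L[ℝ] Y} (hA : IsSelfAdjoint A)
    (hR : IsDissipation R) (hB : MemW11 T B) (ι : Z →L[ℝ] StrongDual ℝ Y)
    (h : Lp Z 2 (timeMeasure T)) (g : Lp Y 2 (timeMeasure T)) :
    (ofRate Z T h, ofRate Y T g) ∈ admissiblePairs T ι A R B y₀ ↔
      IsEnergeticSolution T (rieszRep ι) A R B y₀ h g := by
  obtain ⟨C, hC, hBC⟩ := hB.exists_ae_norm_le hT
  have hH : Continuous (rateHistory T B y₀ g) :=
    continuous_rateHistory hB.1 hC hBC hT y₀ (integrable_coeFn g)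
  have hσ := continuous_drivingForce (rieszRep ι) A h g
  have key : ∀ᵐ t ∂(timeMeasure T),
      (-fderiv ℝ (energy A (fun t => ι (value (ofRate Z T h) t)) t) (value (ofRate Y T g) t) ∈
        subdifferential (fun η => (R (history B y₀ (value (ofRate Y T g)) t) η : EReal))
          (rate (ofRate Y T g) t)) ↔
      (∀ η, ENNReal.ofReal (inner ℝ (drivingForce T (rieszRep ι) A h g t) η)
        ≤ R (rateHistory T B y₀ g t) η) ∧ R (rateHistory T B y₀ g t) (g t) < ⊤ ∧
    (R (rateHistory T B y₀ g t) (g t)).toReal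
      ≤ inner ℝ (drivingForce T (rieszRep ι) A h g t) (g t) := by
    filter_upwards [value_ofRate h, value_ofRate g, ae_restrict_mem measurableSet_Ioo]
      with t h1 h2 ht
    have e : ∀ v, (-fderiv ℝ (energy A (fun t => ι (value (ofRate Z T h) t)) t)
        (value (ofRate Y T g) t)) v = inner ℝ (drivingForce T (rieszRep ι) A h g t) v := by
      intro v
      rw [neg_fderiv_energy hA, drivingForce, inner_sub_left, inner_rieszRep, h1, h2]
    rw [hR.mem_subdifferential_iff, history_eq_rateHistory y₀ (value_ofRate g) ht, rate_ofRate]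
    simp only [e]
  constructor
  · intro hs
    have hs' : ∀ᵐ t ∂(timeMeasure T), _ := hs
    have h1 := (hs'.and key).mono fun t ht => ht.2.1 ht.1
    exact ⟨fun t ht η => stable_of_ae hR hH hσ (h1.mono fun s hs => hs.1 η) ht,
      h1.mono fun t ht => ht.2⟩
  · intro hs
    change ∀ᵐ t ∂(timeMeasure T), _
    filter_upwards [key, hs.balance, ae_restrict_mem measurableSet_Ioo] with t h1 h2 ht
    exact h1.2 ⟨fun η => hs.stable t ht η, h2⟩

end Energetic

/-! ### A priori estimate -/

section APriori

variable {X Y Z : Type*} [NormedAddCommGroup X] [NormedSpace ℝ X]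
  [NormedAddCommGroup Y] [InnerProductSpace ℝ Y] [CompleteSpace Y]
  [NormedAddCommGroup Z] [NormedSpace ℝ Z] [CompleteSpace Z]
  {T : ℝ} {R : X → Y → ℝ≥0∞} {B : ℝ → Y →L[ℝ] X} {y₀ : X}

theorem HasDerivAt.nonneg_of_le_left {ψ : ℝ → ℝ} {ψ' a t : ℝ} (h : HasDerivAt ψ ψ' t) (hat : a < t)
    (hle : ∀ s ∈ Ioo a t, ψ s ≤ ψ t) : 0 ≤ ψ' := by
  have h1 : Tendsto (slope ψ t) (𝓝[<] t) (𝓝 ψ') :=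
    (hasDerivAt_iff_tendsto_slope.1 h).mono_left (nhdsWithin_mono _ fun x hx => ne_of_lt hx)
  refine ge_of_tendsto h1 ?_
  filter_upwards [Ioo_mem_nhdsLT hat] with s hs
  rw [slope_def_field]
  exact div_nonneg_of_nonpos (by linarith [hle s hs]) (by linarith [hs.2])

/-- Pointwise estimate of the rate: the stability inequality at earlier times `s < t` is compared
with the energy balance at `t`, and the difference quotient is sent to its limit `s ↑ t`. -/
theorem IsEnergeticSolution.ae_norm_rate_le (hT : 0 < T)
    {L : ℝ} (hL : 0 ≤ L) (hle : ∀ ζ₁ ζ₂ η,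
      R ζ₁ η ≤ R ζ₂ η + ENNReal.ofReal (L * ‖ζ₁ - ζ₂‖ * ‖η‖))
    (hB : Integrable B (timeMeasure T)) {C : ℝ} (hC : 0 ≤ C)
    (hBC : ∀ᵐ t ∂(timeMeasure T), ‖B t‖ ≤ C) {κ : Z →L[ℝ] Y} {A : Y →L[ℝ] Y} {α : ℝ} (hα : 0 < α)
    (hcoer : ∀ y : Y, α * ‖y‖ ^ 2 ≤ inner ℝ (A y) y) {h : Lp Z 2 (timeMeasure T)}
    {g : Lp Y 2 (timeMeasure T)} (hs : IsEnergeticSolution T κ A R B y₀ h g) :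
    ∀ᵐ t ∂(timeMeasure T), ‖g t‖ ≤ ‖κ (h t)‖ / α
      + L * C / α * primitive T (fun r => ‖g r‖) t := by
  filter_upwards [hs.balance, ae_hasDerivAt_primitive (integrable_coeFn h),
    ae_hasDerivAt_primitive (integrable_coeFn g), ae_restrict_mem measurableSet_Ioo]
    with t ⟨hfin, hbal⟩ hdh hdg ht
  set V := primitive T (fun r => ‖g r‖) t with hV
  have hV0 : 0 ≤ V := primitive_norm_nonneg (integrable_coeFn g) t
  have hdσ : HasDerivAt (drivingForce T κ A h g) (κ (h t) - A (g t)) t :=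
    (κ.hasFDerivAt.comp_hasDerivAt t hdh).sub (A.hasFDerivAt.comp_hasDerivAt t hdg)
  have hdψ : HasDerivAt (fun s => inner ℝ (drivingForce T κ A h g s) (g t)
      + L * C * V * ‖g t‖ * s) (inner ℝ (κ (h t) - A (g t)) (g t) + L * C * V * ‖g t‖) t := by
    have h1 := hdσ.inner ℝ (hasDerivAt_const t (g t))
    have h2 := (hasDerivAt_id t).const_mul (L * C * V * ‖g t‖)
    exact (h1.add h2).congr_deriv (by simp)
  have hnn := HasDerivAt.nonneg_of_le_left hdψ ht.1 (fun s hst => by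
    have h1 := (hs.stable s ⟨hst.1, hst.2.trans ht.2⟩ (g t)).trans
      (hle (rateHistory T B y₀ g s) (rateHistory T B y₀ g t) (g t))
    have h2 : L * ‖rateHistory T B y₀ g s - rateHistory T B y₀ g t‖ * ‖g t‖
        ≤ L * (C * ((t - s) * V)) * ‖g t‖ := by
      rw [norm_sub_rev]
      gcongr
      exact norm_rateHistory_sub_le hB hC hBC hT y₀ (integrable_coeFn g) hst.2.le
    rw [← ENNReal.ofReal_toReal hfin.ne,
      ← ENNReal.ofReal_add ENNReal.toReal_nonneg (by positivity),
      ENNReal.ofReal_le_ofReal_iff (by positivity)] at h1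
    linarith)
  have h3 := hcoer (g t)
  have h4 : inner ℝ (κ (h t)) (g t) ≤ ‖κ (h t)‖ * ‖g t‖ := real_inner_le_norm _ _
  rw [inner_sub_left] at hnn
  have h5 : α * ‖g t‖ ^ 2 ≤ (‖κ (h t)‖ + L * C * V) * ‖g t‖ := by linarith
  have h6 : ‖κ (h t)‖ / α + L * C / α * V = (‖κ (h t)‖ + L * C * V) / α := by ring
  rw [h6, le_div_iff₀ hα]
  rcases (norm_nonneg (g t)).eq_or_lt with h0 | h0
  · rw [← h0, zero_mul]
    positivity
  · nlinarith

theorem primitive_mono_ae {u v : ℝ → ℝ} (hu : Integrable u (timeMeasure T))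
    (hv : Integrable v (timeMeasure T)) (h : u ≤ᵐ[timeMeasure T] v) {t : ℝ} (ht : t ∈ Icc 0 T) :
    primitive T u t ≤ primitive T v t := by
  rw [primitive_eq_setIntegral u ht, primitive_eq_setIntegral v ht]
  refine integral_mono_ae (hu.indicator measurableSet_Iio) (hv.indicator measurableSet_Iio) ?_
  filter_upwards [h] with s hs
  exact indicator_le_indicator hs

/-- Gronwall's inequality in integrated form. -/
theorem primitive_le_of_ae_le {u a : ℝ → ℝ} (hu : Integrable u (timeMeasure T))
    (ha : Integrable a (timeMeasure T)) (hu0 : ∀ t, 0 ≤ primitive T u t) {c K : ℝ} (hK : 0 ≤ K)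
    (hc : ∀ t ∈ Icc 0 T, primitive T a t ≤ c)
    (h : ∀ᵐ t ∂(timeMeasure T), u t ≤ a t + K * primitive T u t) {t : ℝ} (ht : t ∈ Icc 0 T) :
    primitive T u t ≤ c + K * gronwallBound 0 K c t := by
  have hcont : Continuous (primitive T u) := continuous_primitive hu
  have hint : Integrable (primitive T u) (timeMeasure T) :=
    hcont.integrableOn_Icc.mono_set Ioo_subset_Icc_self
  have h1 : ∀ s ∈ Icc 0 T, primitive T u s ≤ c + K * ∫ r in (0 : ℝ)..s, primitive T u r := by
    intro s hs
    have h2 := primitive_mono_ae hu (ha.add (hint.const_mul K)) h hs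
    have h3 : primitive T (a + fun t => K * primitive T u t) s
        = primitive T a s + K * primitive T (primitive T u) s := by
      rw [primitive_add ha (hint.const_mul K)]
      congr 1
      exact primitive_smul K _ s
    have h4 : primitive T (primitive T u) s ≤ ∫ r in (0 : ℝ)..s, primitive T u r :=
      intervalIntegral.integral_mono_on hs.1 (intervalIntegrable_indicator_Ioo hint _ _)
        (hcont.intervalIntegrable _ _) fun r _ => indicator_le_self' (fun x _ => hu0 x) r
    have h5 := hc s hs
    have h6 := mul_le_mul_of_nonneg_left h4 hK
    change primitive T u s ≤ primitive T (a + fun t => K * primitive T u t) s at h2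
    linarith
  have hW0 : ∀ s, 0 ≤ s → 0 ≤ ∫ r in (0 : ℝ)..s, primitive T u r := fun s hs =>
    intervalIntegral.integral_nonneg hs fun r _ => hu0 r
  have hder : ∀ s, HasDerivAt (fun s => ∫ r in (0 : ℝ)..s, primitive T u r) (primitive T u s) s :=
    fun s => intervalIntegral.integral_hasDerivAt_right (hcont.intervalIntegrable _ _)
      (hcont.stronglyMeasurableAtFilter _ _) hcont.continuousAt
  have hg := norm_le_gronwallBound_of_norm_deriv_right_le
    (f := fun s => ∫ r in (0 : ℝ)..s, primitive T u r) (δ := 0) (K := K) (ε := c) (a := 0) (b := T)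
    (fun s _ => (hder s).continuousAt.continuousWithinAt)
    (fun s _ => (hder s).hasDerivWithinAt) (by simp) (fun s hs => by
      rw [Real.norm_of_nonneg (hu0 s), Real.norm_of_nonneg (hW0 s hs.1)]
      linarith [h1 s (Ico_subset_Icc_self hs)]) t ht
  rw [Real.norm_of_nonneg (hW0 t ht.1), sub_zero] at hg
  have := h1 t ht
  have := mul_le_mul_of_nonneg_left hg hK
  linarith

theorem exists_norm_le_of_ae_norm_le (T : ℝ) : ∃ Ω : ℝ, 0 ≤ Ω ∧
    ∀ {G : Type*} [NormedAddCommGroup G] (g f : Lp G 2 (timeMeasure T)) (a b : ℝ), 0 ≤ a →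
      (∀ᵐ t ∂(timeMeasure T), ‖g t‖ ≤ a * ‖f t‖ + b) → ‖g‖ ≤ a * ‖f‖ + Ω * |b| := by
  have hfin : (timeMeasure T) univ ^ (1 / (2 : ℝ≥0∞).toReal) ≠ ⊤ :=
    ENNReal.rpow_ne_top_of_nonneg (by norm_num) (measure_ne_top _ _)
  refine ⟨((timeMeasure T) univ ^ (1 / (2 : ℝ≥0∞).toReal)).toReal, ENNReal.toReal_nonneg,
    fun g f a b ha h => ?_⟩
  have h1 : eLpNorm (fun t => a • ‖f t‖) 2 (timeMeasure T) = ENNReal.ofReal (a * ‖f‖) := by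
    refine (eLpNorm_const_smul a (fun t => ‖f t‖) 2 (timeMeasure T)).trans ?_
    rw [eLpNorm_norm, ENNReal.ofReal_mul ha, Real.enorm_of_nonneg ha,
      Lp.norm_def, ENNReal.ofReal_toReal (Lp.eLpNorm_ne_top _)]
  have h2 : eLpNorm (fun _ : ℝ => b) 2 (timeMeasure T)
      = ENNReal.ofReal (((timeMeasure T) univ ^ (1 / (2 : ℝ≥0∞).toReal)).toReal * |b|) := by
    rw [eLpNorm_const' _ (by norm_num) (by norm_num), ENNReal.ofReal_mul ENNReal.toReal_nonneg,
      ENNReal.ofReal_toReal hfin, mul_comm, Real.enorm_eq_ofReal_abs]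
  have h3 : eLpNorm g 2 (timeMeasure T) ≤ ENNReal.ofReal (a * ‖f‖) + ENNReal.ofReal
      (((timeMeasure T) univ ^ (1 / (2 : ℝ≥0∞).toReal)).toReal * |b|) := by
    rw [← h1, ← h2]
    exact (eLpNorm_mono_ae_real h).trans (eLpNorm_add_le
      ((Lp.aestronglyMeasurable f).norm.const_smul a) aestronglyMeasurable_const (by norm_num))
  rw [← ENNReal.ofReal_add (by positivity) (by positivity)] at h3
  rw [Lp.norm_def]
  exact ENNReal.toReal_le_of_le_ofReal (by positivity) h3

/-- Loads bounded in `H¹₀(0, T; Z)` produce states bounded in `H¹₀(0, T; Y)`. -/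
theorem exists_norm_rate_le [CompleteSpace X] (hT : 0 < T) (hR : IsDissipation R)
    (hB : MemW11 T B) (y₀ : X)
    (κ : Z →L[ℝ] Y) {A : Y →L[ℝ] Y} {α : ℝ} (hα : 0 < α)
    (hcoer : ∀ y : Y, α * ‖y‖ ^ 2 ≤ inner ℝ (A y) y) (M : ℝ) :
    ∃ N : ℝ, ∀ (h : Lp Z 2 (timeMeasure T)) (g : Lp Y 2 (timeMeasure T)), ‖h‖ ≤ M →
      IsEnergeticSolution T κ A R B y₀ h g → ‖g‖ ≤ N := by
  obtain ⟨C, hC, hBC⟩ := hB.exists_ae_norm_le hT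
  obtain ⟨L, hL, hle⟩ := hR.exists_le_add
  obtain ⟨K₀, hK₀, hK₀'⟩ := exists_integral_norm_le T
  set K := L * C / α
  have hK : 0 ≤ K := by positivity
  set c := K₀ * (‖κ‖ * M) / α
  obtain ⟨D, hD⟩ := (isCompact_Icc (a := (0 : ℝ)) (b := T)).bddAbove_image
    (f := fun t => c + K * gronwallBound 0 K c t) (by
      refine (continuous_const.add (continuous_const.mul ?_)).continuousOn
      exact continuous_iff_continuousAt.2 fun x =>
        (hasDerivAt_gronwallBound 0 K c x).continuousAt)
  obtain ⟨Ω, hΩ, hL2⟩ := exists_norm_le_of_ae_norm_le T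
  refine ⟨α⁻¹ * (‖κ‖ * M) + Ω * |K * D|, fun h g hM hs => ?_⟩
  have hκh : ‖κ.compLp h‖ ≤ ‖κ‖ * M :=
    (κ.norm_compLp_le h).trans (mul_le_mul_of_nonneg_left hM (norm_nonneg κ))
  have hgi := integrable_coeFn g
  have hhi : Integrable (fun t => ‖κ (h t)‖ / α) (timeMeasure T) :=
    ((κ.integrable_comp (integrable_coeFn h)).norm).div_const α
  have hpt := hs.ae_norm_rate_le hT hL hle hB.1 hC hBC hα hcoer
  have hV : ∀ t ∈ Icc 0 T, primitive T (fun r => ‖g r‖) t ≤ D := by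
    intro t ht
    refine (primitive_le_of_ae_le hgi.norm hhi (primitive_norm_nonneg hgi) hK ?_ hpt ht).trans
      (hD ⟨t, ht, rfl⟩)
    intro s hs
    refine (le_abs_self _).trans ((norm_primitive_le hhi s).trans ?_)
    have e : ∫ r, ‖‖κ (h r)‖ / α‖ ∂(timeMeasure T)
        = (∫ r, ‖κ.compLp h r‖ ∂(timeMeasure T)) / α := by
      rw [← integral_div]
      refine integral_congr_ae ?_
      filter_upwards [κ.coeFn_compLp h] with r hr
      rw [hr, Real.norm_of_nonneg (by positivity)]
    rw [e]
    exact div_le_div_of_nonneg_right ((hK₀' (κ.compLp h)).trans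
      (mul_le_mul_of_nonneg_left hκh hK₀)) hα.le
  refine (hL2 g (κ.compLp h) α⁻¹ (K * D) (by positivity) ?_).trans (by gcongr)
  filter_upwards [hpt, κ.coeFn_compLp h, ae_restrict_mem measurableSet_Ioo] with t h1 h2 ht
  rw [h2, inv_mul_eq_div]
  have := mul_le_mul_of_nonneg_left (hV t (Ioo_subset_Icc_self ht)) hK
  linarith

end APriori

/-! ### Quadratic form and strong convergence of the loads -/

section VolterraForm

variable {Y : Type*} [NormedAddCommGroup Y] [InnerProductSpace ℝ Y] [CompleteSpace Y] {T : ℝ}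

/-- With `w = ∫₀ g`, the form `∫₀ᵀ ⟪A w, g⟫` equals `½ ⟪A w(T), w(T)⟫`. It suffices to verify this
for continuous `g`, which are dense in `L²`. -/
theorem inner_volterra_nonneg (hT : 0 < T) {A : Y →L[ℝ] Y} (hA : IsSelfAdjoint A)
    (hpos : ∀ y : Y, 0 ≤ inner ℝ (A y) y) (g : Lp Y 2 (timeMeasure T)) :
    0 ≤ inner ℝ (A.compLp (volterra Y T g)) g := by
  have hcl : IsClosed {g : Lp Y 2 (timeMeasure T) |
      0 ≤ inner ℝ (A.compLpL 2 (timeMeasure T) (volterra Y T g)) g} :=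
    isClosed_le continuous_const (by fun_prop)
  suffices hsub : (Lp.boundedContinuousFunction Y 2 (timeMeasure T) : Set _) ⊆
      {g : Lp Y 2 (timeMeasure T) |
        0 ≤ inner ℝ (A.compLpL 2 (timeMeasure T) (volterra Y T g)) g} by
    have := closure_minimal hsub hcl
    rw [(Lp.boundedContinuousFunction_dense Y (timeMeasure T) (by norm_num)).closure_eq] at this
    exact this (mem_univ g)
  intro f hf
  obtain ⟨c, hc⟩ := Lp.mem_boundedContinuousFunction_iff.1 hf
  have hfc : f =ᵐ[timeMeasure T] c := by
    have h1 := ContinuousMap.coeFn_toAEEqFun (timeMeasure T) c.toContinuousMap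
    rw [hc] at h1
    exact h1
  let w : ℝ → Y := fun t => ∫ s in (0 : ℝ)..t, c s
  have hw : ∀ t, HasDerivAt w (c t) t := fun t =>
    intervalIntegral.integral_hasDerivAt_right (c.continuous.intervalIntegrable _ _)
      (c.continuous.stronglyMeasurableAtFilter _ _) c.continuous.continuousAt
  have hwc : Continuous w := continuous_iff_continuousAt.2 fun t => (hw t).continuousAt
  have hwp : ∀ t ∈ Ioo 0 T, primitive T f t = w t := by
    intro t ht
    rw [primitive_congr hfc]
    refine intervalIntegral.integral_congr_ae (ae_of_all _ fun s hs => ?_)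
    rw [uIoc_of_le ht.1.le] at hs
    exact indicator_of_mem (s := Ioo 0 T) ⟨hs.1, hs.2.trans_lt ht.2⟩ _
  have hsymm : ∀ x y, inner ℝ (A x) y = inner ℝ x (A y) :=
    ContinuousLinearMap.isSelfAdjoint_iff_isSymmetric.1 hA
  have hφ : ∀ t, HasDerivAt (fun t => (1 / 2 : ℝ) * inner ℝ (A (w t)) (w t))
      (inner ℝ (A (w t)) (c t)) t := by
    intro t
    have h1 := ((A.hasFDerivAt.comp_hasDerivAt t (hw t)).inner ℝ (hw t)).const_mul (1 / 2 : ℝ)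
    refine h1.congr_deriv ?_
    simp only [Function.comp_apply]
    rw [hsymm (c t) (w t), real_inner_comm (A (w t)) (c t)]
    ring
  have hval : inner ℝ (A.compLpL 2 (timeMeasure T) (volterra Y T f)) f
      = (1 / 2 : ℝ) * inner ℝ (A (w T)) (w T) := by
    rw [L2.inner_def]
    have e1 : ∫ t, inner ℝ (A.compLpL 2 (timeMeasure T) (volterra Y T f) t) (f t) ∂(timeMeasure T)
        = ∫ t, inner ℝ (A (w t)) (c t) ∂(timeMeasure T) := by
      refine integral_congr_ae ?_
      filter_upwards [A.coeFn_compLpL (volterra Y T f), coeFn_volterra f, hfc,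
        ae_restrict_mem measurableSet_Ioo] with t h1 h2 h3 ht
      rw [h1, h2, h3, hwp t ht]
    rw [e1, timeMeasure, ← integral_Ioc_eq_integral_Ioo, ← intervalIntegral.integral_of_le hT.le,
      intervalIntegral.integral_eq_sub_of_hasDerivAt (fun t _ => hφ t)
        (Continuous.intervalIntegrable
          ((A.continuous.comp hwc).inner c.continuous) _ _)]
    simp [w]
  change 0 ≤ inner ℝ (A.compLpL 2 (timeMeasure T) (volterra Y T f)) f
  rw [hval]
  have := hpos (w T)
  positivity

theorem WeaklyConverges.tendsto_inner {H : Type*} [NormedAddCommGroup H] [InnerProductSpace ℝ H]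
    {x : ℕ → H} {x₀ : H} (hx : WeaklyConverges x x₀) {C : ℝ} (hC : ∀ n, ‖x n‖ ≤ C) {y : ℕ → H}
    {y₀ : H} (hy : Tendsto y atTop (𝓝 y₀)) :
    Tendsto (fun n => inner ℝ (x n) (y n)) atTop (𝓝 (inner ℝ x₀ y₀)) := by
  have h1 : Tendsto (fun n => inner ℝ (x n) y₀) atTop (𝓝 (inner ℝ x₀ y₀)) := by
    have := hx (innerSL ℝ y₀)
    simpa only [innerSL_apply_apply, real_inner_comm] using this
  have h2 : Tendsto (fun n => inner ℝ (x n) (y n - y₀)) atTop (𝓝 0) := by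
    refine squeeze_zero_norm (a := fun n => C * ‖y n - y₀‖) (fun n => ?_) ?_
    · exact (norm_inner_le_norm _ _).trans (by gcongr; exact hC n)
    · simpa using (tendsto_iff_norm_sub_tendsto_zero.1 hy).const_mul C
  have h3 := h1.add h2
  rw [add_zero] at h3
  refine h3.congr fun n => ?_
  rw [← inner_add_right]
  congr 1
  abel

theorem tendsto_volterra_zero {Y : Type*} [NormedAddCommGroup Y] [NormedSpace ℝ Y]
    {e : ℕ → Lp Y 2 (timeMeasure T)} {M : ℝ} (hM : ∀ n, ‖e n‖ ≤ M)
    (h : ∀ t, Tendsto (fun n => primitive T (e n) t) atTop (𝓝 0)) :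
    Tendsto (fun n => volterra Y T (e n)) atTop (𝓝 0) := by
  obtain ⟨K, hK, hK'⟩ := exists_integral_norm_le T
  have hb : ∀ n t, ‖primitive T (e n) t‖ ≤ K * M := fun n t =>
    (norm_primitive_le (integrable_coeFn (e n)) t).trans
      ((hK' (e n)).trans (mul_le_mul_of_nonneg_left (hM n) hK))
  have h1 : Tendsto (fun n => ∫⁻ t, ‖primitive T (e n) t‖ₑ ^ 2 ∂(timeMeasure T)) atTop
      (𝓝 (∫⁻ _, 0 ∂(timeMeasure T))) := by
    refine tendsto_lintegral_of_dominated_convergence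
      (fun _ => ENNReal.ofReal (K * M) ^ 2) (fun n => ?_) (fun n => ae_of_all _ fun t => ?_) ?_
      (ae_of_all _ fun t => ?_)
    · exact (continuous_primitive (integrable_coeFn (e n))).enorm.measurable.pow_const 2
    · dsimp only
      rw [← ofReal_norm]
      have := hb n t
      gcongr
    · rw [lintegral_const]
      exact ENNReal.mul_ne_top (ENNReal.pow_ne_top ENNReal.ofReal_ne_top) (measure_ne_top _ _)
    · have h2 : Tendsto (fun n => ‖primitive T (e n) t‖ₑ ^ 2) atTop (𝓝 (‖(0 : Y)‖ₑ ^ 2)) :=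
        ((ENNReal.continuous_pow 2).tendsto _).comp ((continuous_enorm.tendsto (0 : Y)).comp (h t))
      simpa using h2
  have h2 : ∀ n, ∫⁻ t, ‖primitive T (e n) t‖ₑ ^ 2 ∂(timeMeasure T)
      = ENNReal.ofReal (‖volterra Y T (e n)‖ ^ 2) := fun n => by
    rw [← lintegral_enorm_sq]
    refine lintegral_congr_ae ?_
    filter_upwards [coeFn_volterra (e n)] with t ht
    rw [ht]
  simp only [h2, lintegral_zero] at h1
  have h3 : Tendsto (fun n => ‖volterra Y T (e n)‖ ^ 2) atTop (𝓝 0) := by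
    have := (ENNReal.tendsto_toReal ENNReal.zero_ne_top).comp h1
    simpa [Function.comp_def] using this
  refine tendsto_zero_iff_norm_tendsto_zero.2 ?_
  have := h3.sqrt
  simpa using this

/-- Compactness of `κ` upgrades weak convergence of the rates of the loads to strong convergence of
the loads themselves. -/
theorem tendsto_volterra_of_weaklyConverges {Z : Type*} [NormedAddCommGroup Z] [NormedSpace ℝ Z]
    [CompleteSpace Z] {κ : Z →L[ℝ] Y} (hκ : IsCompactOperator κ) {h : ℕ → Lp Z 2 (timeMeasure T)}
    {M : ℝ} (hM : ∀ n, ‖h n‖ ≤ M) {h₀ : Lp Z 2 (timeMeasure T)}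
    (hw : WeaklyConverges (fun n => κ.compLp (h n)) (κ.compLp h₀)) :
    Tendsto (fun n => volterra Y T (κ.compLp (h n))) atTop (𝓝 (volterra Y T (κ.compLp h₀))) := by
  obtain ⟨K, hK, hK'⟩ := exists_integral_norm_le T
  have hprim : ∀ (e : Lp Z 2 (timeMeasure T)) t,
      primitiveAt Y T t (κ.compLp e) = κ (primitive T e t) := fun e t => by
    rw [primitiveAt_apply, primitive_congr (κ.coeFn_compLp e), primitive_clm κ (integrable_coeFn e)]
  have h1 : ∀ t, Tendsto (fun n => primitiveAt Y T t (κ.compLp (h n))) atTop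
      (𝓝 (primitiveAt Y T t (κ.compLp h₀))) := by
    intro t
    have h2 := hw.map (primitiveAt Y T t)
    simp only [hprim] at h2 ⊢
    exact IsCompactOperator.tendsto_of_weaklyConverges hκ (C := K * M) (fun n =>
      (norm_primitive_le (integrable_coeFn (h n)) t).trans
        ((hK' (h n)).trans (mul_le_mul_of_nonneg_left (hM n) hK))) h2
  have h3 : Tendsto (fun n => volterra Y T (κ.compLp (h n) - κ.compLp h₀)) atTop (𝓝 0) := by
    refine tendsto_volterra_zero (M := ‖κ‖ * M + ‖κ.compLp h₀‖) (fun n => ?_) fun t => ?_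
    · refine (norm_sub_le _ _).trans ?_
      have := (κ.norm_compLp_le (h n)).trans (mul_le_mul_of_nonneg_left (hM n) (norm_nonneg κ))
      gcongr
    · simp only [← primitiveAt_apply, map_sub]
      exact tendsto_sub_nhds_zero_iff.2 (h1 t)
  simp only [map_sub] at h3
  exact tendsto_sub_nhds_zero_iff.1 h3

end VolterraForm

/-! ### Passage to the limit in the inclusion -/

section Limit

variable {X Y Z : Type*} [NormedAddCommGroup X] [NormedSpace ℝ X]
  [NormedAddCommGroup Y] [InnerProductSpace ℝ Y]
  [NormedAddCommGroup Z] [NormedSpace ℝ Z]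
  {T : ℝ} {R : X → Y → ℝ≥0∞} {B : ℝ → Y →L[ℝ] X} {y₀ : X}

/-- The driving force as an element of `L²(0, T; Y)`. -/
noncomputable def drivingForceLp (κ : Z →L[ℝ] Y) (A : Y →L[ℝ] Y) (h : Lp Z 2 (timeMeasure T))
    (g : Lp Y 2 (timeMeasure T)) : Lp Y 2 (timeMeasure T) :=
  volterra Y T (κ.compLp h) - A.compLp (volterra Y T g)

theorem coeFn_drivingForceLp [CompleteSpace Y] [CompleteSpace Z]
    (κ : Z →L[ℝ] Y) (A : Y →L[ℝ] Y) (h : Lp Z 2 (timeMeasure T))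
    (g : Lp Y 2 (timeMeasure T)) :
    drivingForceLp κ A h g =ᵐ[timeMeasure T] drivingForce T κ A h g := by
  filter_upwards [Lp.coeFn_sub (volterra Y T (κ.compLp h)) (A.compLp (volterra Y T g)),
    coeFn_volterra (κ.compLp h), A.coeFn_compLp (volterra Y T g), coeFn_volterra g]
    with t h1 h2 h3 h4
  rw [drivingForceLp, h1, Pi.sub_apply, h2, h3, h4, drivingForce,
    primitive_congr (κ.coeFn_compLp h), primitive_clm κ (integrable_coeFn h)]

theorem totalDissipation_ofRate [CompleteSpace Y]
    (g : Lp Y 2 (timeMeasure T)) (v : H10 T Y) :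
    totalDissipation R B y₀ (ofRate Y T g) v
      = ∫⁻ t, R (rateHistory T B y₀ g t) (rate v t) ∂(timeMeasure T) := by
  refine lintegral_congr_ae ?_
  filter_upwards [ae_restrict_mem measurableSet_Ioo] with t ht
  rw [history_eq_rateHistory y₀ (value_ofRate g) ht]

theorem inner_drivingForceLp [CompleteSpace Y] [CompleteSpace Z]
    (κ : Z →L[ℝ] Y) (A : Y →L[ℝ] Y) (h : Lp Z 2 (timeMeasure T))
    (g v : Lp Y 2 (timeMeasure T)) : inner ℝ (drivingForceLp κ A h g) v
      = ∫ t, inner ℝ (drivingForce T κ A h g t) (v t) ∂(timeMeasure T) := by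
  rw [L2.inner_def]
  refine integral_congr_ae ?_
  filter_upwards [coeFn_drivingForceLp κ A h g] with t ht
  rw [ht]

theorem integrable_inner_drivingForce [CompleteSpace Y] [CompleteSpace Z]
    (κ : Z →L[ℝ] Y) (A : Y →L[ℝ] Y)
    (h : Lp Z 2 (timeMeasure T)) (g v : Lp Y 2 (timeMeasure T)) :
    Integrable (fun t => inner ℝ (drivingForce T κ A h g t) (v t)) (timeMeasure T) := by
  refine (L2.integrable_inner (𝕜 := ℝ) (drivingForceLp κ A h g) v).congr ?_
  filter_upwards [coeFn_drivingForceLp κ A h g] with t ht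
  rw [ht]

theorem ofReal_integral_le_lintegral {μ : Measure ℝ} {f : ℝ → ℝ} (hf : Integrable f μ) :
    ENNReal.ofReal (∫ t, f t ∂μ) ≤ ∫⁻ t, ENNReal.ofReal (f t) ∂μ := by
  calc ENNReal.ofReal (∫ t, f t ∂μ) ≤ ENNReal.ofReal (∫ t, max (f t) 0 ∂μ) :=
        ENNReal.ofReal_le_ofReal (integral_mono hf hf.pos_part fun t => le_max_left _ _)
    _ = ∫⁻ t, ENNReal.ofReal (max (f t) 0) ∂μ :=
        ofReal_integral_eq_lintegral_ofReal hf.pos_part (ae_of_all _ fun t => le_max_right _ _)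
    _ = ∫⁻ t, ENNReal.ofReal (f t) ∂μ := by
        refine lintegral_congr fun t => ?_
        rw [ENNReal.ofReal_max, ENNReal.ofReal_zero]
        exact max_eq_left zero_le

variable {κ : Z →L[ℝ] Y} {A : Y →L[ℝ] Y}

/-- Stability tested with an arbitrary rate and integrated over `(0, T)`. -/
theorem IsEnergeticSolution.inner_le_totalDissipation [CompleteSpace Y] [CompleteSpace Z]
    {h : Lp Z 2 (timeMeasure T)}
    {g : Lp Y 2 (timeMeasure T)} (hs : IsEnergeticSolution T κ A R B y₀ h g) (v : H10 T Y) :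
    ENNReal.ofReal (inner ℝ (drivingForceLp κ A h g) (v : L2Pair Y T).snd)
      ≤ totalDissipation R B y₀ (ofRate Y T g) v := by
  rw [totalDissipation_ofRate, inner_drivingForceLp]
  refine (ofReal_integral_le_lintegral (integrable_inner_drivingForce κ A h g _)).trans
    (lintegral_mono_ae ?_)
  filter_upwards [ae_restrict_mem measurableSet_Ioo] with t ht using hs.stable t ht _

theorem IsEnergeticSolution.ae_inner_nonneg {h : Lp Z 2 (timeMeasure T)}
    {g : Lp Y 2 (timeMeasure T)} (hs : IsEnergeticSolution T κ A R B y₀ h g) :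
    ∀ᵐ t ∂(timeMeasure T), 0 ≤ inner ℝ (drivingForce T κ A h g t) (g t) :=
  hs.balance.mono fun _ ht => ENNReal.toReal_nonneg.trans ht.2

theorem IsEnergeticSolution.totalDissipation_le [CompleteSpace Y] [CompleteSpace Z]
    {h : Lp Z 2 (timeMeasure T)}
    {g : Lp Y 2 (timeMeasure T)} (hs : IsEnergeticSolution T κ A R B y₀ h g) :
    totalDissipation R B y₀ (ofRate Y T g) (ofRate Y T g)
      ≤ ENNReal.ofReal (inner ℝ (drivingForceLp κ A h g) g) := by
  rw [totalDissipation_ofRate, inner_drivingForceLp, ofReal_integral_eq_lintegral_ofReal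
    (integrable_inner_drivingForce κ A h g g) hs.ae_inner_nonneg]
  refine lintegral_mono_ae (hs.balance.mono fun t ht => ?_)
  exact ENNReal.le_ofReal_iff_toReal_le ht.1.ne (ENNReal.toReal_nonneg.trans ht.2) |>.2 ht.2

theorem IsEnergeticSolution.mem_admissibleRates [CompleteSpace Y]
    (hR : IsDissipation R)
    {h : Lp Z 2 (timeMeasure T)} {g : Lp Y 2 (timeMeasure T)}
    (hs : IsEnergeticSolution T κ A R B y₀ h g) : ofRate Y T g ∈ admissibleRates T R := by
  refine hs.balance.mono fun t ht => ?_
  rw [rate_ofRate]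
  exact (hR.mem_dom_iff _ _).2 ht.1

/-- Localisation: an integrated stability inequality, tested with all admissible rates, gives
stability at all times. The test rates are `1_E η` for measurable sets `E` of times. -/
theorem stable_of_inner_le_totalDissipation [CompleteSpace X] [CompleteSpace Y] [CompleteSpace Z]
    (hT : 0 < T) (hR : IsDissipation R) (hB : MemW11 T B)
    (h : Lp Z 2 (timeMeasure T)) (g : Lp Y 2 (timeMeasure T))
    (hle : ∀ v ∈ admissibleRates T R,
      ENNReal.ofReal (inner ℝ (drivingForceLp κ A h g) (v : L2Pair Y T).snd)
        ≤ totalDissipation R B y₀ (ofRate Y T g) v) {t : ℝ} (ht : t ∈ Ioo 0 T) (η : Y) :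
    ENNReal.ofReal (inner ℝ (drivingForce T κ A h g t) η) ≤ R (rateHistory T B y₀ g t) η := by
  obtain ⟨C, hC, hBC⟩ := hB.exists_ae_norm_le hT
  have hH : Continuous (rateHistory T B y₀ g) :=
    continuous_rateHistory hB.1 hC hBC hT y₀ (integrable_coeFn g)
  have hσ := continuous_drivingForce κ A h g
  refine stable_of_ae hR hH hσ (η := η) ?_ ht
  by_cases hη : η ∈ dom R
  swap
  · refine ae_of_all _ fun s => ?_
    rw [not_lt_top_iff.1 fun h' => hη ((hR.mem_dom_iff (rateHistory T B y₀ g s) η).2 h')]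
    exact le_top
  have hf : Measurable fun s => R (rateHistory T B y₀ g s) η := by
    have : LowerSemicontinuous fun s => R (rateHistory T B y₀ g s) η := fun s y hy =>
      ((hH.prodMk continuous_const).tendsto s).eventually (hR.lowerSemicontinuous_uncurry _ y hy)
    exact this.measurable
  have hσm : Continuous fun s => inner ℝ (drivingForce T κ A h g s) η := hσ.inner continuous_const
  have hg : Measurable fun s => ENNReal.ofReal (inner ℝ (drivingForce T κ A h g s) η) :=
    (ENNReal.continuous_ofReal.comp hσm).measurable
  let E : Set ℝ := {s | R (rateHistory T B y₀ g s) η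
    < ENNReal.ofReal (inner ℝ (drivingForce T κ A h g s) η)}
  have hE : MeasurableSet E := measurableSet_lt hf hg
  let e : Lp Y 2 (timeMeasure T) := indicatorConstLp 2 hE (measure_ne_top _ _) η
  have he : e =ᵐ[timeMeasure T] E.indicator fun _ => η := indicatorConstLp_coeFn
  have hadm : ofRate Y T e ∈ admissibleRates T R := by
    refine he.mono fun s hs => ?_
    rw [rate_ofRate, hs]
    by_cases hsE : s ∈ E
    · rwa [indicator_of_mem hsE]
    · rw [indicator_of_notMem hsE, hR.mem_dom_iff 0, hR.apply_zero]
      exact ENNReal.zero_lt_top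
  have hint : Integrable (fun s => inner ℝ (drivingForce T κ A h g s) η) (timeMeasure T) :=
    hσm.integrableOn_Icc.mono_set Ioo_subset_Icc_self
  have h1 := hle _ hadm
  have h2 : inner ℝ (drivingForceLp κ A h g) (ofRate Y T e : L2Pair Y T).snd
      = ∫ s in E, inner ℝ (drivingForce T κ A h g s) η ∂(timeMeasure T) := by
    rw [ofRate_snd_coe, inner_drivingForceLp, ← integral_indicator hE]
    refine integral_congr_ae (he.mono fun s hs => ?_)
    dsimp only
    rw [hs]
    by_cases hsE : s ∈ E <;> simp [hsE]
  have h3 : totalDissipation R B y₀ (ofRate Y T g) (ofRate Y T e)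
      = ∫⁻ s in E, R (rateHistory T B y₀ g s) η ∂(timeMeasure T) := by
    rw [totalDissipation_ofRate, ← lintegral_indicator hE]
    refine lintegral_congr_ae (he.mono fun s hs => ?_)
    dsimp only
    rw [rate_ofRate, hs]
    by_cases hsE : s ∈ E <;> simp [hsE, hR.apply_zero]
  have hposE : ∀ s ∈ E, 0 ≤ inner ℝ (drivingForce T κ A h g s) η := fun s hs =>
    (ENNReal.ofReal_pos.1 (pos_of_gt hs)).le
  rw [h2, h3, ofReal_integral_eq_lintegral_ofReal hint.integrableOn
    ((ae_restrict_iff' hE).2 (ae_of_all _ hposE))] at h1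
  have hfin : ∫⁻ s in E, R (rateHistory T B y₀ g s) η ∂(timeMeasure T) ≠ ⊤ := by
    refine ne_top_of_le_ne_top (hint.integrableOn (s := E)).lintegral_lt_top.ne ?_
    exact setLIntegral_mono hg fun s hs => le_of_lt hs
  by_contra hcon
  have hne : timeMeasure T E ≠ 0 := fun h0 => hcon (by
    refine (measure_eq_zero_iff_ae_notMem.1 h0).mono fun s hs => ?_
    exact not_lt.1 hs)
  exact absurd h1 (not_le.2 (setLIntegral_strict_mono hE hne hg hfin (ae_of_all _ fun s hs => hs)))

/-- Stability together with the integrated energy inequality gives the pointwise energy balance,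
since the defect in the balance has a sign. -/
theorem IsEnergeticSolution.of_totalDissipation_le [CompleteSpace X] [CompleteSpace Y] [CompleteSpace Z]
    (hT : 0 < T) (hR : IsDissipation R)
    (hB : MemW11 T B) {h : Lp Z 2 (timeMeasure T)} {g : Lp Y 2 (timeMeasure T)}
    (hst : ∀ t ∈ Ioo 0 T, ∀ η : Y,
      ENNReal.ofReal (inner ℝ (drivingForce T κ A h g t) η) ≤ R (rateHistory T B y₀ g t) η)
    (h0 : 0 ≤ inner ℝ (drivingForceLp κ A h g) g)
    (hle : totalDissipation R B y₀ (ofRate Y T g) (ofRate Y T g)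
      ≤ ENNReal.ofReal (inner ℝ (drivingForceLp κ A h g) g)) :
    IsEnergeticSolution T κ A R B y₀ h g := by
  refine ⟨hst, ?_⟩
  obtain ⟨C, hC, hBC⟩ := hB.exists_ae_norm_le hT
  have hH : Continuous (rateHistory T B y₀ g) :=
    continuous_rateHistory hB.1 hC hBC hT y₀ (integrable_coeFn g)
  have hm : AEMeasurable (fun t => R (rateHistory T B y₀ g t) (g t)) (timeMeasure T) :=
    hR.aemeasurable_comp hH.aestronglyMeasurable (Lp.aestronglyMeasurable g)
  rw [totalDissipation_ofRate, rate_ofRate] at hle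
  have hne := ne_top_of_le_ne_top ENNReal.ofReal_ne_top hle
  have hfin := ae_lt_top' hm hne
  have hi := integrable_toReal_of_lintegral_ne_top hm hne
  have hi' := integrable_inner_drivingForce κ A h g g
  have hnn : ∀ᵐ t ∂(timeMeasure T), 0 ≤ (R (rateHistory T B y₀ g t) (g t)).toReal
      - inner ℝ (drivingForce T κ A h g t) (g t) := by
    filter_upwards [hfin, ae_restrict_mem measurableSet_Ioo] with t h1 ht
    have := (ENNReal.ofReal_le_iff_le_toReal h1.ne).1 (hst t ht (g t))
    linarith
  have hzero : ∫ t, ((R (rateHistory T B y₀ g t) (g t)).toReal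
      - inner ℝ (drivingForce T κ A h g t) (g t)) ∂(timeMeasure T) = 0 := by
    refine le_antisymm ?_ (integral_nonneg_of_ae hnn)
    rw [integral_sub hi hi', integral_toReal hm hfin, ← inner_drivingForceLp, sub_nonpos]
    exact ENNReal.toReal_le_of_le_ofReal h0 hle
  filter_upwards [hfin, (integral_eq_zero_iff_of_nonneg_ae hnn (hi.sub hi')).1 hzero] with t h1 h2
  exact ⟨h1, (sub_eq_zero.1 h2).le⟩

/-- Energetic solutions are closed under weak convergence of the rates of load and state, provided
the loads are bounded in the space `Z`, which embeds compactly. -/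
theorem IsEnergeticSolution.of_weaklyConverges [CompleteSpace X] [CompleteSpace Y] [CompleteSpace Z]
    (hT : 0 < T) (hR : IsDissipation R)
    (hB : MemW11 T B) (hconv : DissipationConvergence T R B y₀) (hA : IsSelfAdjoint A)
    (hpos : ∀ y : Y, 0 ≤ inner ℝ (A y) y) (hκ : IsCompactOperator κ)
    {h : ℕ → Lp Z 2 (timeMeasure T)} {g : ℕ → Lp Y 2 (timeMeasure T)} {M N : ℝ}
    (hM : ∀ n, ‖h n‖ ≤ M) (hN : ∀ n, ‖g n‖ ≤ N) {h₀ : Lp Z 2 (timeMeasure T)}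
    {g₀ : Lp Y 2 (timeMeasure T)}
    (hh : WeaklyConverges (fun n => κ.compLp (h n)) (κ.compLp h₀)) (hg : WeaklyConverges g g₀)
    (hs : ∀ n, IsEnergeticSolution T κ A R B y₀ (h n) (g n)) :
    IsEnergeticSolution T κ A R B y₀ h₀ g₀ := by
  let P : Lp Y 2 (timeMeasure T) →L[ℝ] Lp Y 2 (timeMeasure T) :=
    A.compLpL 2 (timeMeasure T) ∘L volterra Y T
  have hP : ∀ u, A.compLp (volterra Y T u) = P u := fun u => rfl
  have hload := tendsto_volterra_of_weaklyConverges hκ hM hh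
  have hFw : WeaklyConverges (fun n => drivingForceLp κ A (h n) (g n))
      (drivingForceLp κ A h₀ g₀) := by
    intro f
    simp only [drivingForceLp, hP, map_sub]
    exact ((f.continuous.tendsto _).comp hload).sub (hg.map P f)
  obtain ⟨C, hC⟩ : ∃ C, ∀ n, ‖drivingForceLp κ A (h n) (g n)‖ ≤ C := by
    obtain ⟨C₁, hC₁⟩ := hload.norm.bddAbove_range
    refine ⟨C₁ + ‖P‖ * N, fun n => (norm_sub_le _ _).trans (add_le_add (hC₁ ⟨n, rfl⟩) ?_)⟩
    exact (P.le_opNorm _).trans (mul_le_mul_of_nonneg_left (hN n) (norm_nonneg P))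
  have hq := hconv.2 (fun n => ofRate Y T (g n)) (ofRate Y T g₀)
    (fun n => (hs n).mem_admissibleRates hR) (hg.map (ofRate Y T))
  have hstab : ∀ v ∈ admissibleRates T R,
      ENNReal.ofReal (inner ℝ (drivingForceLp κ A h₀ g₀) (v : L2Pair Y T).snd)
        ≤ totalDissipation R B y₀ (ofRate Y T g₀) v := by
    intro v hv
    obtain ⟨w, -, hwv, hlim⟩ := hq.2 v hv
    have hw' : Tendsto (fun n => (w n : L2Pair Y T).snd) atTop (𝓝 (v : L2Pair Y T).snd) :=
      ((WithLp.continuous_snd 2 _ _).comp continuous_subtype_val).tendsto v |>.comp hwv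
    have h1 := (ENNReal.continuous_ofReal.tendsto _).comp (hFw.tendsto_inner hC hw')
    rw [← h1.limsup_eq]
    exact (limsup_le_limsup (Eventually.of_forall fun n =>
      (hs n).inner_le_totalDissipation (w n))).trans hlim
  -- The quadratic form `u ↦ ⟪P u, u⟫` is nonnegative, hence convex and weakly lower semicontinuous:
  -- it lies above its affine approximation at `g₀`.
  have hquad : ∀ n, inner ℝ (drivingForceLp κ A (h n) (g n)) (g n)
      ≤ inner ℝ (g n) (volterra Y T (κ.compLp (h n)))
        - (inner ℝ (g n) (P g₀) + inner ℝ (P (g n)) g₀ - inner ℝ (P g₀) g₀) := by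
    intro n
    have h1 := inner_volterra_nonneg hT hA hpos (g n - g₀)
    rw [hP, map_sub, inner_sub_left, inner_sub_right, inner_sub_right] at h1
    rw [drivingForceLp, hP, inner_sub_left, real_inner_comm (g n) (volterra Y T _),
      real_inner_comm (P g₀) (g n)]
    linarith
  have hlim : Tendsto (fun n => inner ℝ (g n) (volterra Y T (κ.compLp (h n)))
        - (inner ℝ (g n) (P g₀) + inner ℝ (P (g n)) g₀ - inner ℝ (P g₀) g₀)) atTop
      (𝓝 (inner ℝ (drivingForceLp κ A h₀ g₀) g₀)) := by
    have e : inner ℝ (drivingForceLp κ A h₀ g₀) g₀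
        = inner ℝ g₀ (volterra Y T (κ.compLp h₀))
          - (inner ℝ g₀ (P g₀) + inner ℝ (P g₀) g₀ - inner ℝ (P g₀) g₀) := by
      rw [drivingForceLp, hP, inner_sub_left, real_inner_comm g₀ (volterra Y T _),
        real_inner_comm g₀ (P g₀)]
      ring
    rw [e]
    have hPg : ∀ n, ‖P (g n)‖ ≤ ‖P‖ * N := fun n =>
      (P.le_opNorm _).trans (mul_le_mul_of_nonneg_left (hN n) (norm_nonneg P))
    exact (hg.tendsto_inner hN hload).sub (((hg.tendsto_inner hN tendsto_const_nhds).add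
      ((hg.map P).tendsto_inner hPg tendsto_const_nhds)).sub_const _)
  have h0 : ∀ n, 0 ≤ inner ℝ (drivingForceLp κ A (h n) (g n)) (g n) := fun n => by
    rw [inner_drivingForceLp]
    exact integral_nonneg_of_ae (hs n).ae_inner_nonneg
  refine .of_totalDissipation_le hT hR hB
    (fun t ht η => stable_of_inner_le_totalDissipation hT hR hB h₀ g₀ hstab ht η)
    (ge_of_tendsto' hlim fun n => (h0 n).trans (hquad n)) ?_
  refine hq.1.trans ?_
  rw [← ((ENNReal.continuous_ofReal.tendsto _).comp hlim).liminf_eq]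
  exact liminf_le_liminf (Eventually.of_forall fun n =>
    (hs n).totalDissipation_le.trans (ENNReal.ofReal_le_ofReal (hquad n)))

end Limit

/-! ### Limits of loads and of minimizing sequences -/

section Existence

variable {X Y Z : Type*} [NormedAddCommGroup X] [NormedSpace ℝ X]
  [NormedAddCommGroup Y] [InnerProductSpace ℝ Y]
  [NormedAddCommGroup Z] [NormedSpace ℝ Z] {T : ℝ}

theorem compLp_injective {κ : Z →L[ℝ] Y} (hκ : Function.Injective κ) :
    Function.Injective (fun h : Lp Z 2 (timeMeasure T) => κ.compLp h) := by
  intro f f' hff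
  refine Lp.ext ?_
  have h1 : κ.compLp f =ᵐ[timeMeasure T] κ.compLp f' := by
    rw [show κ.compLp f = κ.compLp f' from hff]
  filter_upwards [h1, κ.coeFn_compLp f, κ.coeFn_compLp f'] with t h1 h2 h3
  exact hκ (by rw [← h2, ← h3, h1])

/-- Loads whose norms in `H¹₀(0, T; Z)` converge and whose rates have weakly convergent images in
`L²(0, T; Y)` have a limit load, and the norm is lower semicontinuous. -/
theorem IsReflexive.exists_load_of_weaklyConverges [CompleteSpace Y] [CompleteSpace Z]
    (hZ : IsReflexive Z) {κ : Z →L[ℝ] Y}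
    (hκ : Function.Injective κ) {h : ℕ → Lp Z 2 (timeMeasure T)} {G : Lp Y 2 (timeMeasure T)}
    {r : ℝ} (hr : Tendsto (fun n => ‖ofRate Z T (h n)‖) atTop (𝓝 r))
    (hw : WeaklyConverges (fun n => κ.compLp (h n)) G) :
    ∃ h₀ : Lp Z 2 (timeMeasure T), κ.compLp h₀ = G ∧ ‖ofRate Z T h₀‖ ≤ r := by
  have key : ∀ ε > 0, ∃ f : Lp Z 2 (timeMeasure T), κ.compLp f = G ∧ ‖ofRate Z T f‖ ≤ r + ε :=
    fun ε hε => hZ.exists_rate_of_weaklyConverges κ hκ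
      ((hr.eventually_lt_const (lt_add_of_pos_right r hε)).mono fun _ h => h.le) hw
  obtain ⟨h₀, hG, -⟩ := key 1 one_pos
  refine ⟨h₀, hG, le_of_forall_pos_le_add fun ε hε => ?_⟩
  obtain ⟨f, hf, hfr⟩ := key ε hε
  rwa [compLp_injective hκ (hG.trans hf.symm)]

theorem isEnergeticSolution_zero {κ : Z →L[ℝ] Y} {A : Y →L[ℝ] Y} {R : X → Y → ℝ≥0∞}
    (hR : IsDissipation R) {B : ℝ → Y →L[ℝ] X} {y₀ : X} :
    IsEnergeticSolution T κ A R B y₀ (0 : Lp Z 2 (timeMeasure T))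
      (0 : Lp Y 2 (timeMeasure T)) := by
  have h0 : ∀ t, drivingForce T κ A (0 : Lp Z 2 (timeMeasure T)) (0 : Lp Y 2 (timeMeasure T)) t
      = 0 := fun t => by
    rw [drivingForce, ← primitiveAt_apply, ← primitiveAt_apply]
    simp
  refine ⟨fun t _ η => by rw [h0, inner_zero_left, ENNReal.ofReal_zero]; exact zero_le, ?_⟩
  filter_upwards [Lp.coeFn_zero Y 2 (timeMeasure T)] with t ht
  rw [ht, Pi.zero_apply, hR.apply_zero, inner_zero_right]
  exact ⟨ENNReal.zero_lt_top, le_rfl⟩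

theorem WeaklyLSC.le_of_tendsto {E : Type*} [NormedAddCommGroup E] [NormedSpace ℝ E] {j : E → ℝ}
    (hj : WeaklyLSC j) {x : ℕ → E} {x₀ : E} (hx : WeaklyConverges x x₀) {c : ℝ}
    (hc : Tendsto (fun n => j (x n)) atTop (𝓝 c)) : j x₀ ≤ c := by
  have h1 := hj x x₀ hx
  have h2 : Tendsto (fun n => (j (x n) : EReal)) atTop (𝓝 (c : EReal)) :=
    (continuous_coe_real_ereal.tendsto c).comp hc
  rw [h2.liminf_eq] at h1
  exact_mod_cast h1

end Existence

end HistoryRIS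

open HistoryRIS in
theorem theorem4p2
    {X Y Z : Type*}
    [NormedAddCommGroup X] [NormedSpace ℝ X] [CompleteSpace X]
    [NormedAddCommGroup Y] [InnerProductSpace ℝ Y] [CompleteSpace Y]
    [NormedAddCommGroup Z] [NormedSpace ℝ Z] [CompleteSpace Z]
    (T : ℝ) (hT : 0 < T)
    (A : Y →L[ℝ] Y) (hA : IsSelfAdjoint A)
    (α : ℝ) (hα : 0 < α) (hcoer : ∀ y : Y, α * ‖y‖ ^ 2 ≤ inner ℝ (A y) y)
    (R : X → Y → ℝ≥0∞) (hR : HistoryRIS.IsDissipation R)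
    (B : ℝ → Y →L[ℝ] X) (hB : HistoryRIS.MemW11 T B) (y₀ : X)
    (hconv : HistoryRIS.DissipationConvergence T R B y₀)
    (hZ : HistoryRIS.IsReflexive Z)
    (ι : Z →L[ℝ] StrongDual ℝ Y) (hι : Function.Injective ι) (hιc : IsCompactOperator ι)
    (j : HistoryRIS.H10 T Y → ℝ) (hj : HistoryRIS.WeaklyLSC j) (hjb : BddBelow (Set.range j)) :
    ∃ p ∈ HistoryRIS.admissiblePairs T ι A R B y₀,
      ∀ p' ∈ HistoryRIS.admissiblePairs T ι A R B y₀,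
        HistoryRIS.objective j p ≤ HistoryRIS.objective j p' := by
  have hmem := fun h g => mem_admissiblePairs_iff (y₀ := y₀) hT hA hR hB ι h g
  have hpos : ∀ y : Y, 0 ≤ inner ℝ (A y) y := fun y =>
    (mul_nonneg hα.le (sq_nonneg _)).trans (hcoer y)
  obtain ⟨m, hm⟩ := hjb
  have hmj : ∀ q, m ≤ j q := fun q => hm ⟨q, rfl⟩
  set S := admissiblePairs T ι A R B y₀
  have hne : (objective j '' S).Nonempty :=
    ⟨_, _, (hmem 0 0).2 (isEnergeticSolution_zero hR), rfl⟩
  have hbdd : BddBelow (objective j '' S) := ⟨m, by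
    rintro _ ⟨p, -, rfl⟩
    unfold objective
    nlinarith [hmj p.2, sq_nonneg ‖p.1‖]⟩
  obtain ⟨u, -, hu, huS⟩ := exists_seq_tendsto_sInf hne hbdd
  choose p hpS hpu using huS
  set I := sInf (objective j '' S)
  let h : ℕ → Lp Z 2 (timeMeasure T) := fun n => ((p n).1 : L2Pair Z T).snd
  let g : ℕ → Lp Y 2 (timeMeasure T) := fun n => ((p n).2 : L2Pair Y T).snd
  have hp : ∀ n, p n = (ofRate Z T (h n), ofRate Y T (g n)) := fun n =>
    Prod.ext (ofRate_snd hT _).symm (ofRate_snd hT _).symm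
  have hsol : ∀ n, IsEnergeticSolution T (rieszRep ι) A R B y₀ (h n) (g n) := fun n =>
    (hmem _ _).1 (hp n ▸ hpS n)
  have hobj : ∀ n, j (ofRate Y T (g n)) + 1 / 2 * ‖ofRate Z T (h n)‖ ^ 2 = u n := fun n => by
    rw [← hpu n, hp n]
    rfl
  obtain ⟨D, hD⟩ := hu.bddAbove_range
  have hM : ∀ n, ‖ofRate Z T (h n)‖ ≤ Real.sqrt (2 * (D - m)) := fun n => by
    refine Real.le_sqrt_of_sq_le ?_
    have h1 : u n ≤ D := hD ⟨n, rfl⟩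
    have h2 := hmj (ofRate Y T (g n))
    have h3 := hobj n
    linarith
  set M := Real.sqrt (2 * (D - m))
  have hMh : ∀ n, ‖h n‖ ≤ M := fun n => (norm_le_norm_ofRate _).trans (hM n)
  obtain ⟨N, hN⟩ := exists_norm_rate_le hT hR hB y₀ (rieszRep ι) hα hcoer M
  have hNg : ∀ n, ‖g n‖ ≤ N := fun n => hN _ _ (hMh n) (hsol n)
  obtain ⟨r, -, φ₁, hφ₁, hr⟩ := tendsto_subseq_of_bounded (Metric.isBounded_Icc 0 M)
    (fun n => ⟨norm_nonneg (ofRate Z T (h n)), hM n⟩)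
  obtain ⟨G, φ₂, hφ₂, hG⟩ := exists_weaklyConverges_subseq
    (fun n => (rieszRep ι).compLp (h (φ₁ n))) (C := ‖rieszRep ι‖ * M) fun n =>
      ((rieszRep ι).norm_compLp_le _).trans (by gcongr; exact hMh _)
  obtain ⟨g₀, φ₃, hφ₃, hg⟩ := exists_weaklyConverges_subseq
    (fun n => g (φ₁ (φ₂ n))) (C := N) fun n => hNg _
  let ψ : ℕ → ℕ := fun n => φ₁ (φ₂ (φ₃ n))
  have hψ : Tendsto ψ atTop atTop :=
    hφ₁.tendsto_atTop.comp (hφ₂.tendsto_atTop.comp hφ₃.tendsto_atTop)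
  have hrψ : Tendsto (fun n => ‖ofRate Z T (h (ψ n))‖) atTop (𝓝 r) :=
    hr.comp (hφ₂.tendsto_atTop.comp hφ₃.tendsto_atTop)
  have hGψ : WeaklyConverges (fun n => (rieszRep ι).compLp (h (ψ n))) G :=
    hG.comp hφ₃.tendsto_atTop
  obtain ⟨h₀, rfl, hh₀⟩ :=
    hZ.exists_load_of_weaklyConverges (rieszRep_injective hι) hrψ hGψ
  have hsol₀ : IsEnergeticSolution T (rieszRep ι) A R B y₀ h₀ g₀ :=
    .of_weaklyConverges hT hR hB hconv hA hpos (isCompactOperator_rieszRep hιc)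
      (fun n => hMh (ψ n)) (fun n => hNg (ψ n)) hGψ hg fun n => hsol (ψ n)
  refine ⟨(ofRate Z T h₀, ofRate Y T g₀), (hmem _ _).2 hsol₀, fun p' hp' => ?_⟩
  have hjlim : Tendsto (fun n => j (ofRate Y T (g (ψ n)))) atTop (𝓝 (I - 1 / 2 * r ^ 2)) := by
    refine ((hu.comp hψ).sub ((hrψ.pow 2).const_mul (1 / 2))).congr fun n => ?_
    simp only [Function.comp_apply, ← hobj (ψ n)]
    ring
  have h1 := hj.le_of_tendsto (hg.map (ofRate Y T)) hjlim
  have h2 : ‖ofRate Z T h₀‖ ^ 2 ≤ r ^ 2 := by gcongr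
  refine le_trans ?_ (csInf_le hbdd ⟨p', hp', rfl⟩)
  change j (ofRate Y T g₀) + 1 / 2 * ‖ofRate Z T h₀‖ ^ 2 ≤ I
  linarith
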